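/- Let $\ell,\varepsilon>0$, $I=(-\ell,\ell)$, $f\in C^2(\mathbb R)$, and let $Q(s)=\dfrac{s}{1+s^2}$ or $Q(s)=\dfrac{s}{\sqrt{1-s^2}}$. Let $U\in C^2([-\ell,\ell])$ be any function with $-\varepsilon^{-1}<U_x<0$ on $[-\ell,\ell]$ (for instance, any such smooth approximation $U^\varepsilon$ of an approximate steady state of $u_t+f(u)_x=Q(\varepsilon u_x)_x$), and let $$\mathcal L v:=\varepsilon Q'(\varepsilon U_x)\,v_{xx}+\varepsilon^2Q''(\varepsilon U_x)U_{xx}\,v_x-(f'(U)v)_x$$ be the linearization around $U$ of $u\mapsto Q(\varepsilon u_x)_x-f(u)_x$. Consider the eigenvalue problem $$\mathcal L v=\lambda v\ \text{ in } I,\qquad v(\pm\ell)=0,$$ with $\lambda\in\mathbb C$ and eigenfunctions $v\not\equiv0$, $v\in C^2([-\ell,\ell];\mathbb C)$. Its eigenvalues are all real and form an infinite sequence $(\lambda_k)_{k\ge1}$ with $$\dots<\lambda_3<\lambda_2<\lambda_1<0,\qquad \lambda_k\to-\infty\ \text{ as } k\to\infty.$$ To each $\lambda_k$ there corresponds, up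 to multiplication by constants, a single eigenfunction; it can be chosen as a real-valued function $\varphi_k$, and $\varphi_k$ has exactly $k-1$ zeros in $I$. Moreover, for the weight $$\rho(x)=\rho_0\exp\Big(-\frac1\varepsilon\int_{x_0}^x\frac{f'(U(s))}{Q'(\varepsilon U_x(s))}\,ds\Big),\qquad \rho_0>0,\ x_0\in[-\ell,\ell],$$ the sequence $(\varphi_k)_{k\ge1}$ is an orthogonal basis of the weighted space $L^2_\rho(I)$, that is, of $L^2(I;\rho(x)\,dx)$. -/

import Mathlib

open Set MeasureTheory Filter

noncomputable section

namespace Metastab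

/-- The non-monotone dissipation flux `Q(s) = s / (1 + s²)`. -/
def fluxNonmono (s : ℝ) : ℝ := s / (1 + s ^ 2)

/-- The unbounded, singular dissipation flux `Q(s) = s / √(1 - s²)`; it is used only on `(-1, 1)`. -/
def fluxUnbounded (s : ℝ) : ℝ := s / √(1 - s ^ 2)

/-- The derivative with respect to `x` of a function on the closed interval `[-ℓ, ℓ]`
(one-sided at the two end points). -/
def dx {E : Type*} [NormedAddCommGroup E] [NormedSpace ℝ E] (ℓ : ℝ) (v : ℝ → E) : ℝ → E :=
  derivWithin v (Icc (-ℓ) ℓ)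

/-- The linearization around `U` of `u ↦ Q(ε u_x)_x - f(u)_x`:
`ℒ v = ε Q'(ε U_x) v_xx + ε² Q''(ε U_x) U_xx v_x - (f'(U) v)_x`,
acting on real- or complex-valued functions. -/
def linearizedOp {E : Type*} [NormedAddCommGroup E] [NormedSpace ℝ E]
    (Q f : ℝ → ℝ) (ε ℓ : ℝ) (U : ℝ → ℝ) (v : ℝ → E) (x : ℝ) : E :=
  (ε * deriv Q (ε * dx ℓ U x)) • dx ℓ (dx ℓ v) x
    + (ε ^ 2 * deriv (deriv Q) (ε * dx ℓ U x) * dx ℓ (dx ℓ U) x) • dx ℓ v x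
    - dx ℓ (fun y => deriv f (U y) • v y) x

/-- `v` is a (classical) eigenfunction, with eigenvalue `μ`, of the Dirichlet problem
`ℒ v = μ v` in `(-ℓ, ℓ)`, `v(±ℓ) = 0`. The values of `v` outside `[-ℓ, ℓ]` play no role. -/
structure IsEigenfunction {𝕜 : Type*} [RCLike 𝕜]
    (Q f : ℝ → ℝ) (ε ℓ : ℝ) (U : ℝ → ℝ) (μ : 𝕜) (v : ℝ → 𝕜) : Prop where
  contDiffOn : ContDiffOn ℝ 2 v (Icc (-ℓ) ℓ)
  left : v (-ℓ) = 0
  right : v ℓ = 0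
  nonzero : ∃ x ∈ Icc (-ℓ) ℓ, v x ≠ 0
  equation : ∀ x ∈ Ioo (-ℓ) ℓ, linearizedOp Q f ε ℓ U v x = μ * v x

/-- The weight `ρ(x) = ρ₀ exp (-∫_{x₀}^x f'(U(s)) / (ε Q'(ε U_x(s))) ds)`. -/
def weight (Q f : ℝ → ℝ) (ε ℓ : ℝ) (U : ℝ → ℝ) (ρ₀ x₀ x : ℝ) : ℝ :=
  ρ₀ * Real.exp (-∫ s in x₀..x, deriv f (U s) / (ε * deriv Q (ε * dx ℓ U s)))

/-- The measure `ρ(x) dx` on `I = (-ℓ, ℓ)`; `L²_ρ(I)` is `Lp ℝ 2` of this measure. -/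
def weightMeasure (ℓ : ℝ) (ρ : ℝ → ℝ) : Measure ℝ :=
  (volume.restrict (Ioo (-ℓ) ℓ)).withDensity fun x => ENNReal.ofReal (ρ x)

/-- The functions `φ k` form an orthogonal basis of the Hilbert space `L²(μ)`: they are
square-integrable, nonzero, pairwise orthogonal, and their linear span is dense. -/
def IsOrthogonalBasisL2 (μ : Measure ℝ) (φ : ℕ → ℝ → ℝ) : Prop :=
  ∃ h : ∀ k, MemLp (φ k) 2 μ,
    (∀ k, (h k).toLp (φ k) ≠ 0) ∧
    (Pairwise fun j k => inner ℝ ((h j).toLp (φ j)) ((h k).toLp (φ k)) = 0) ∧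
    (Submodule.span ℝ (range fun k => (h k).toLp (φ k))).topologicalClosure = ⊤

end Metastab

end

/-! In divergence form `ℒ v = (a v' - b v)'` with `a = ε Q'(ε U_x)` and `b = f'(U)`. The weight
satisfies `ρ' = -(b / a) ρ`, so `w = ρ v` and `z = a v' - b v` obey `w' = A z`, `z' = λ r w` with `A
= ρ / a`, `r = 1 / ρ`. Since `|ε U_x| < 1`, `Q' > 0` where it is evaluated, and this is a regular
Sturm–Liouville problem `(w' / A)' = -κ r w`, `κ = -λ`, without zeroth order term. Integrating `(w̄
z)'` shows that `λ` is real and negative.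

Eigenvalues come from shooting. In polar form `w = R sin θ`, `z = R cos θ` one has `θ' = A cos² θ +
κ r sin² θ`, and for `κ > 0` the Dirichlet condition at `b` says that `θ(b)` is a multiple of `π`.
This end angle is continuous and strictly increasing in `κ` (both from `IsPruferAngle.sub_eq`),
below `π` at `κ = 0` and unbounded, so each `(k + 1) π` is hit exactly once. As `θ` increases in
`x`, it crosses `k` multiples of `π` in between: these are the zeros.

Completeness is elementary. Picone's inequality (`IsSolution.mul_integral_sq_le`) gives the Rayleigh
bound with constant `κ n` for functions vanishing at the zeros of `W n`. If `u` is orthogonal to the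
first `n` eigenfunctions, some combination of `u` with them vanishes at these `n` zeros, and
expanding by orthogonality transfers the bound to `u`. Hence the Fourier remainder of a function of
finite energy `E` is at most `E / κ n → 0`, and test functions suffice for density. -/

namespace SturmLiouville

/-! ### The Prüfer angle and amplitude -/

open Real intervalIntegral

/-- A continuous function on `ℝ` which solves the Prüfer equation on `[a, b]` and starts at `0`. -/
structure IsPruferAngle (A r : ℝ → ℝ) (a b κ : ℝ) (θ : ℝ → ℝ) : Prop where
  continuous : Continuous θ
  apply_left : θ a = 0
  hasDerivAt : ∀ x ∈ Icc a b,
    HasDerivAt θ (A x * cos (θ x) ^ 2 + κ * r x * sin (θ x) ^ 2) x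

lemma abs_cos_sq_sub_cos_sq_le (x y : ℝ) : |cos x ^ 2 - cos y ^ 2| ≤ 2 * |x - y| := by
  have h : cos x ^ 2 - cos y ^ 2 = (cos x - cos y) * (cos x + cos y) := by ring
  rw [h, abs_mul, mul_comm]
  refine mul_le_mul ?_ ?_ (abs_nonneg _) (by norm_num)
  · calc |cos x + cos y| ≤ |cos x| + |cos y| := abs_add_le _ _
      _ ≤ 1 + 1 := add_le_add (abs_cos_le_one _) (abs_cos_le_one _)
      _ = 2 := by norm_num
  · have := Real.lipschitzWith_cos.dist_le_mul x y
    simpa [Real.dist_eq] using this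

theorem exists_isPruferAngle {A r : ℝ → ℝ} (hA : Continuous A) (hr : Continuous r) {a b : ℝ}
    (hab : a < b) (κ : ℝ) : ∃ θ, IsPruferAngle A r a b κ θ := by
  -- Working on `[a - 1, b + 1]` yields two-sided derivatives at `a` and `b`.
  obtain ⟨M, hM⟩ := (isCompact_Icc (a := a - 1) (b := b + 1)).exists_bound_of_continuousOn
    hA.continuousOn
  obtain ⟨N, hN⟩ := (isCompact_Icc (a := a - 1) (b := b + 1)).exists_bound_of_continuousOn
    (continuous_const.mul hr : Continuous fun x => κ * r x).continuousOn
  have hM0 : 0 ≤ M := (norm_nonneg _).trans (hM a ⟨by linarith, by linarith⟩)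
  have hN0 : 0 ≤ N := (norm_nonneg _).trans (hN a ⟨by linarith, by linarith⟩)
  have ha : a ∈ Icc (a - 1) (b + 1) := ⟨by linarith, by linarith⟩
  have hle : a - 1 ≤ b + 1 := by linarith
  set F : ℝ → ℝ → ℝ := fun x y => A x * cos y ^ 2 + κ * r x * sin y ^ 2 with hF
  lift M to NNReal using hM0
  lift N to NNReal using hN0
  -- The field is bounded by `M + N` for all `y`, so a ball of radius (speed) × (time) cannot be
  -- left and the solution is global on the interval.
  have hP : IsPicardLindelof F (⟨a, ha⟩ : Icc (a - 1) (b + 1)) 0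
      ((M + N) * (max (b + 1 - a) (a - (a - 1))).toNNReal) 0 (M + N) (2 * (M + N)) := by
    refine ⟨fun t ht => ?_, fun x _ => ?_, fun t ht x _ => ?_, ?_⟩
    · apply LipschitzWith.lipschitzOnWith
      refine LipschitzWith.of_dist_le_mul fun x y => ?_
      rw [Real.dist_eq, Real.dist_eq]
      have h : F t x - F t y = (A t - κ * r t) * (cos x ^ 2 - cos y ^ 2) := by
        simp only [hF, Real.sin_sq]; ring
      have h1 : |A t - κ * r t| ≤ M + N :=
        (abs_sub _ _).trans (add_le_add (hM t ht) (hN t ht))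
      rw [h, abs_mul]
      calc |A t - κ * r t| * |cos x ^ 2 - cos y ^ 2| ≤ (M + N) * (2 * |x - y|) := by
            gcongr
            exact abs_cos_sq_sub_cos_sq_le x y
        _ = _ := by push_cast; ring
    · simp only [hF]
      fun_prop
    · calc ‖F t x‖ ≤ ‖A t‖ * ‖cos x ^ 2‖ + ‖κ * r t‖ * ‖sin x ^ 2‖ := by
            rw [← norm_mul, ← norm_mul]; exact norm_add_le _ _
        _ ≤ M * 1 + N * 1 := by
            gcongr
            · exact hM t ht
            · rw [norm_of_nonneg (sq_nonneg _)]; exact cos_sq_le_one x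
            · exact hN t ht
            · rw [norm_of_nonneg (sq_nonneg _)]; exact sin_sq_le_one x
        _ = _ := by push_cast; ring
    · simp only [NNReal.coe_mul, NNReal.coe_add, NNReal.coe_zero, sub_zero]
      rw [Real.coe_toNNReal _ (le_max_of_le_right (by linarith))]
  obtain ⟨α, h0, hα⟩ := hP.exists_eq_forall_mem_Icc_hasDerivWithinAt₀
  have hc : ContinuousOn α (Icc (a - 1) (b + 1)) := fun x hx => (hα x hx).continuousWithinAt
  have heq : ∀ x ∈ Icc (a - 1) (b + 1),
      IccExtend hle ((Icc (a - 1) (b + 1)).domRestrict α) x = α x := fun x hx => by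
    rw [IccExtend_of_mem _ _ hx]; rfl
  refine ⟨IccExtend hle ((Icc (a - 1) (b + 1)).domRestrict α),
    (continuousOn_iff_continuous_domRestrict.1 hc).Icc_extend', ?_, fun x hx => ?_⟩
  · rw [heq a ha]; exact h0
  · have hx' : x ∈ Icc (a - 1) (b + 1) := ⟨by linarith [hx.1], by linarith [hx.2]⟩
    have hn : Icc (a - 1) (b + 1) ∈ nhds x := Icc_mem_nhds (by linarith [hx.1]) (by linarith [hx.2])
    rw [heq x hx']
    exact ((hα x hx').hasDerivAt hn).congr_of_eventuallyEq
      (Filter.eventually_of_mem hn heq)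

/-- The first order form `W' = A Z`, `Z' = -κ r W` of the equation `(W' / A)' = -κ r W`. -/
structure IsSolution (A r : ℝ → ℝ) (a b κ : ℝ) (W Z : ℝ → ℝ) : Prop where
  continuous_fst : Continuous W
  continuous_snd : Continuous Z
  hasDerivAt_fst : ∀ x ∈ Icc a b, HasDerivAt W (A x * Z x) x
  hasDerivAt_snd : ∀ x ∈ Icc a b, HasDerivAt Z (-(κ * r x * W x)) x

/-- The Prüfer amplitude of a Prüfer angle. -/
noncomputable def amplitude (A r : ℝ → ℝ) (a κ : ℝ) (θ : ℝ → ℝ) (x : ℝ) : ℝ :=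
  exp (∫ s in a..x, (A s - κ * r s) * sin (θ s) * cos (θ s))

lemma amplitude_pos (A r : ℝ → ℝ) (a κ : ℝ) (θ : ℝ → ℝ) (x : ℝ) : 0 < amplitude A r a κ θ x :=
  exp_pos _

section

variable {A r : ℝ → ℝ} {a b κ : ℝ} {θ : ℝ → ℝ}

lemma IsPruferAngle.hasDerivAt_amplitude (hA : Continuous A) (hr : Continuous r)
    (h : IsPruferAngle A r a b κ θ) (x : ℝ) :
    HasDerivAt (amplitude A r a κ θ)
      (amplitude A r a κ θ x * ((A x - κ * r x) * sin (θ x) * cos (θ x))) x := by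
  have hθ := h.continuous
  have hc : Continuous fun s => (A s - κ * r s) * sin (θ s) * cos (θ s) := by fun_prop
  exact (hc.integral_hasStrictDerivAt a x).hasDerivAt.exp

/-- The amplitude solves `R' = R (A - κ r) sin θ cos θ`, which is what polar coordinates require;
the rest is `sin² + cos² = 1`. -/
theorem IsPruferAngle.isSolution (hA : Continuous A) (hr : Continuous r)
    (h : IsPruferAngle A r a b κ θ) :
    IsSolution A r a b κ (fun x => amplitude A r a κ θ x * sin (θ x))
      (fun x => amplitude A r a κ θ x * cos (θ x)) := by
  have hd := h.hasDerivAt_amplitude hA hr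
  have hc : Continuous (amplitude A r a κ θ) :=
    continuous_iff_continuousAt.2 fun x => (hd x).continuousAt
  have hθ := h.continuous
  refine ⟨by fun_prop, by fun_prop, fun x hx => ?_, fun x hx => ?_⟩
  · convert! (hd x).mul (h.hasDerivAt x hx).sin using 1
    linear_combination (amplitude A r a κ θ x * A x * cos (θ x)) * sin_sq_add_cos_sq (θ x) * (-1)
  · convert! (hd x).mul (h.hasDerivAt x hx).cos using 1
    linear_combination (amplitude A r a κ θ x * κ * r x * sin (θ x)) * sin_sq_add_cos_sq (θ x)

/-- For `κ > 0` the derivative is a convex combination of the positive numbers `A` and `κ r`. -/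
lemma IsPruferAngle.strictMonoOn (hA0 : ∀ x, 0 < A x) (hr0 : ∀ x, 0 < r x) (hκ : 0 < κ)
    (h : IsPruferAngle A r a b κ θ) : StrictMonoOn θ (Icc a b) := by
  refine strictMonoOn_of_deriv_pos (convex_Icc a b) h.continuous.continuousOn fun x hx => ?_
  rw [interior_Icc] at hx
  rw [(h.hasDerivAt x (Ioo_subset_Icc_self hx)).deriv]
  have := sin_sq_add_cos_sq (θ x)
  by_cases hs : sin (θ x) = 0
  · have : cos (θ x) ^ 2 = 1 := by rw [hs] at this; linarith
    rw [this, hs]; simpa using hA0 x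
  · have h1 := hA0 x
    have h2 := hr0 x
    have h3 : 0 < κ * r x * sin (θ x) ^ 2 := by positivity
    have h4 : 0 ≤ A x * cos (θ x) ^ 2 := by positivity
    linarith

/-- The difference of two Prüfer angles in integrated form. -/
theorem IsPruferAngle.sub_eq (hA : Continuous A) (hr : Continuous r) (hab : a < b)
    {κ₁ κ₂ : ℝ} {θ₁ θ₂ : ℝ → ℝ}
    (h₁ : IsPruferAngle A r a b κ₁ θ₁) (h₂ : IsPruferAngle A r a b κ₂ θ₂) :
    ∃ c : ℝ → ℝ, Continuous c ∧ (∀ x, |c x| ≤ |κ₂ * r x - A x|) ∧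
      (θ₂ b - θ₁ b) * exp (-∫ s in a..b, c s) =
        (κ₂ - κ₁) * ∫ x in a..b, exp (-∫ s in a..x, c s) * (r x * sin (θ₁ x) ^ 2) := by
  have hθ₁ := h₁.continuous
  have hθ₂ := h₂.continuous
  -- From `sin² θ₂ - sin² θ₁ = sin (θ₂ - θ₁) sin (θ₁ + θ₂)`, the difference `δ = θ₂ - θ₁` solves the
  -- linear equation `δ' = c δ + (κ₂ - κ₁) r sin² θ₁`. Using `sinc` keeps `c` continuous where the
  -- angles meet; the exponential is the integrating factor.
  set c : ℝ → ℝ := fun x => (κ₂ * r x - A x) * sinc (θ₂ x - θ₁ x) * sin (θ₁ x + θ₂ x) with hcdef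
  have hc : Continuous c := by
    have := continuous_sinc
    fun_prop
  have hC : ∀ x, HasDerivAt (fun x => exp (-∫ s in a..x, c s))
      (exp (-∫ s in a..x, c s) * (-c x)) x := fun x =>
    ((hc.integral_hasStrictDerivAt a x).hasDerivAt.neg).exp
  have hCc : Continuous fun x => exp (-∫ s in a..x, c s) :=
    continuous_iff_continuousAt.2 fun x => (hC x).continuousAt
  refine ⟨c, hc, fun x => ?_, ?_⟩
  · rw [hcdef]
    simp only [abs_mul]
    have h1 := abs_sinc_le_one (θ₂ x - θ₁ x)
    have h2 := abs_sin_le_one (θ₁ x + θ₂ x)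
    calc |κ₂ * r x - A x| * |sinc (θ₂ x - θ₁ x)| * |sin (θ₁ x + θ₂ x)|
        ≤ |κ₂ * r x - A x| * 1 * 1 := by gcongr
      _ = _ := by ring
  · have hder : ∀ x ∈ uIcc a b, HasDerivAt
        (fun x => (θ₂ x - θ₁ x) * exp (-∫ s in a..x, c s))
        ((κ₂ - κ₁) * (exp (-∫ s in a..x, c s) * (r x * sin (θ₁ x) ^ 2))) x := by
      intro x hx
      rw [uIcc_of_le hab.le] at hx
      convert! ((h₂.hasDerivAt x hx).sub (h₁.hasDerivAt x hx)).mul (hC x) using 1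
      have hs : sin (θ₂ x) ^ 2 - sin (θ₁ x) ^ 2
          = (θ₂ x - θ₁ x) * sinc (θ₂ x - θ₁ x) * sin (θ₁ x + θ₂ x) := by
        have : (θ₂ x - θ₁ x) * sinc (θ₂ x - θ₁ x) = sin (θ₂ x - θ₁ x) := by
          by_cases h0 : θ₂ x - θ₁ x = 0
          · simp [h0]
          · rw [sinc_of_ne_zero h0]; field_simp
        rw [this, sin_sub, sin_add]
        linear_combination (sin (θ₂ x) ^ 2) * sin_sq_add_cos_sq (θ₁ x) * (-1)
          + (sin (θ₁ x) ^ 2) * sin_sq_add_cos_sq (θ₂ x)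
      simp only [hcdef, cos_sq', Pi.sub_apply]
      linear_combination (exp (-∫ s in a..x, (κ₂ * r s - A s) * sinc (θ₂ s - θ₁ s) *
        sin (θ₁ s + θ₂ s))) * (A x - κ₂ * r x) * hs
    have hint := integral_eq_sub_of_hasDerivAt hder
      ((by fun_prop : Continuous fun x => (κ₂ - κ₁) *
        (exp (-∫ s in a..x, c s) * (r x * sin (θ₁ x) ^ 2))).intervalIntegrable _ _)
    rw [intervalIntegral.integral_const_mul] at hint
    rw [hint, h₁.apply_left, h₂.apply_left]
    simp

end

end SturmLiouville

/-! ### Dependence of the end angle on the parameter, and counting of zeros -/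

namespace SturmLiouville

open Real intervalIntegral

section

variable {A r : ℝ → ℝ} {a b κ : ℝ} {θ : ℝ → ℝ}

/-- On a multiple of `π` the angle moves with speed `A > 0`, so it cannot stay there. This makes the
monotonicity in `κ` strict. -/
lemma IsPruferAngle.exists_sin_ne_zero (hA0 : ∀ x, 0 < A x) (hab : a < b)
    (h : IsPruferAngle A r a b κ θ) : ∃ x ∈ Icc a b, sin (θ x) ≠ 0 := by
  by_contra! hcon
  obtain ⟨x, hx⟩ : ∃ x, x ∈ Ioo a b := nonempty_Ioo.2 hab
  have hx' := Ioo_subset_Icc_self hx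
  have h1 := (h.hasDerivAt x hx').sin
  have h2 : HasDerivAt (fun x => sin (θ x)) 0 x :=
    (hasDerivAt_const x (0 : ℝ)).congr_of_eventuallyEq
      (Filter.eventually_of_mem (Icc_mem_nhds hx.1 hx.2) hcon)
  have h3 := h1.unique h2
  have h4 := sin_sq_add_cos_sq (θ x)
  rw [hcon x hx'] at h3 h4
  have h5 : cos (θ x) ^ 2 = 1 := by linarith
  have h6 : cos (θ x) ≠ 0 := by rintro h; rw [h] at h5; norm_num at h5
  rw [h5] at h3
  have := hA0 x
  simp [h6, this.ne'] at h3

theorem IsPruferAngle.lt_of_lt (hA : Continuous A) (hr : Continuous r) (hA0 : ∀ x, 0 < A x)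
    (hr0 : ∀ x, 0 < r x) (hab : a < b) {κ₁ κ₂ : ℝ} {θ₁ θ₂ : ℝ → ℝ}
    (h₁ : IsPruferAngle A r a b κ₁ θ₁) (h₂ : IsPruferAngle A r a b κ₂ θ₂) (hκ : κ₁ < κ₂) :
    θ₁ b < θ₂ b := by
  obtain ⟨c, hc, -, heq⟩ := h₁.sub_eq hA hr hab h₂
  obtain ⟨x, hx, hsx⟩ := h₁.exists_sin_ne_zero hA0 hab
  have hθ₁ := h₁.continuous
  have hCc : Continuous fun x => ∫ s in a..x, c s :=
    continuous_iff_continuousAt.2 fun x => (hc.integral_hasStrictDerivAt a x).hasDerivAt.continuousAt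
  have hpos : 0 < ∫ x in a..b, exp (-∫ s in a..x, c s) * (r x * sin (θ₁ x) ^ 2) := by
    refine intervalIntegral.integral_pos hab ?_ (fun y _ => ?_) ⟨x, hx, ?_⟩
    · fun_prop
    · have := (hr0 y).le
      positivity
    · have := hr0 x
      positivity
  have : 0 < (θ₂ b - θ₁ b) * exp (-∫ s in a..b, c s) := by
    rw [heq]; exact mul_pos (sub_pos.2 hκ) hpos
  linarith [pos_of_mul_pos_left this (exp_pos _).le]

/-- The integrated difference formula gives a Lipschitz bound near each `κ₁`. -/
theorem continuous_pruferAngle_right (hA : Continuous A) (hr : Continuous r) (hab : a < b)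
    {θ : ℝ → ℝ → ℝ} (h : ∀ κ, IsPruferAngle A r a b κ (θ κ)) : Continuous fun κ => θ κ b := by
  rw [continuous_iff_continuousAt]
  intro κ₁
  obtain ⟨M, hM⟩ := (isCompact_Icc (a := a) (b := b)).exists_bound_of_continuousOn hA.continuousOn
  obtain ⟨R, hR⟩ := (isCompact_Icc (a := a) (b := b)).exists_bound_of_continuousOn hr.continuousOn
  have hM0 : 0 ≤ M := (norm_nonneg _).trans (hM a ⟨le_rfl, hab.le⟩)
  have hR0 : 0 ≤ R := (norm_nonneg _).trans (hR a ⟨le_rfl, hab.le⟩)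
  -- Bounds the integral of `c` uniformly for `|κ₂ - κ₁| < 1`.
  set C := ((|κ₁| + 1) * R + M) * (b - a) with hC
  have key : ∀ κ₂, |κ₂ - κ₁| < 1 →
      |θ κ₂ b - θ κ₁ b| ≤ |κ₂ - κ₁| * ((exp C * R) * (b - a) * exp C) := by
    intro κ₂ hκ₂
    obtain ⟨c, hc, hcb, heq⟩ := (h κ₁).sub_eq hA hr hab (h κ₂)
    have hκ₂' : |κ₂| ≤ |κ₁| + 1 := by
      have := abs_sub_abs_le_abs_sub κ₂ κ₁
      linarith
    have hint : ∀ x ∈ Icc a b, |∫ s in a..x, c s| ≤ C := by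
      intro x hx
      have := norm_integral_le_of_norm_le_const (a := a) (b := x) (f := c)
        (C := (|κ₁| + 1) * R + M) fun s hs => by
          rw [uIoc_of_le hx.1] at hs
          have hs' : s ∈ Icc a b := ⟨hs.1.le, hs.2.trans hx.2⟩
          calc ‖c s‖ ≤ |κ₂ * r s - A s| := hcb s
            _ ≤ |κ₂ * r s| + |A s| := abs_sub _ _
            _ = |κ₂| * |r s| + |A s| := by rw [abs_mul]
            _ ≤ (|κ₁| + 1) * R + M := by
              gcongr
              · exact hR s hs'
              · exact hM s hs'
      refine this.trans ?_
      rw [hC, abs_of_nonneg (sub_nonneg.2 hx.1)]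
      have := hx.2
      gcongr
    have hI : |∫ x in a..b, exp (-∫ s in a..x, c s) * (r x * sin (θ κ₁ x) ^ 2)|
        ≤ (exp C * R) * (b - a) := by
      have := norm_integral_le_of_norm_le_const (a := a) (b := b)
        (f := fun x => exp (-∫ s in a..x, c s) * (r x * sin (θ κ₁ x) ^ 2))
        (C := exp C * R) fun s hs => by
          rw [uIoc_of_le hab.le] at hs
          have hs' : s ∈ Icc a b := ⟨hs.1.le, hs.2⟩
          rw [norm_mul, norm_mul, norm_of_nonneg (exp_pos _).le,
            norm_of_nonneg (sq_nonneg (sin _))]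
          calc exp (-∫ s in a..s, c s) * (‖r s‖ * sin (θ κ₁ s) ^ 2)
              ≤ exp C * (R * 1) := by
                gcongr
                · exact (neg_le_abs _).trans (hint s hs')
                · exact hR s hs'
                · exact sin_sq_le_one _
            _ = _ := by ring
      rwa [abs_of_nonneg (sub_nonneg.2 hab.le)] at this
    have h1 : θ κ₂ b - θ κ₁ b = (κ₂ - κ₁) *
        (∫ x in a..b, exp (-∫ s in a..x, c s) * (r x * sin (θ κ₁ x) ^ 2)) *
          exp (∫ s in a..b, c s) := by
      rw [← heq, mul_assoc, ← exp_add]; simp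
    rw [h1, abs_mul, abs_mul, mul_assoc, abs_of_pos (exp_pos _)]
    have hba : 0 ≤ b - a := by linarith
    gcongr
    exact (le_abs_self _).trans (hint b ⟨hab.le, le_rfl⟩)
  rw [ContinuousAt, tendsto_iff_dist_tendsto_zero]
  refine squeeze_zero' (Eventually.of_forall fun _ => dist_nonneg)
    (g := fun κ₂ => |κ₂ - κ₁| * ((exp C * R) * (b - a) * exp C)) ?_ ?_
  · filter_upwards [Metric.ball_mem_nhds κ₁ one_pos] with κ₂ hκ₂
    exact key κ₂ (by simpa [Real.dist_eq] using hκ₂)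
  · have : Continuous fun κ₂ => |κ₂ - κ₁| * ((exp C * R) * (b - a) * exp C) := by fun_prop
    simpa using this.tendsto κ₁

/-- At `κ = 0` the component `R cos θ` is a positive constant, so the angle never even reaches `π /
2`. -/
lemma IsPruferAngle.lt_pi_of_zero (hA : Continuous A) (hr : Continuous r) (hab : a < b)
    (h : IsPruferAngle A r a b 0 θ) : θ b < π := by
  have hs := h.isSolution hA hr
  have hconst := constant_of_has_deriv_right_zero (a := a) (b := b) hs.continuous_snd.continuousOn
    fun x hx => by
      simpa using (hs.hasDerivAt_snd x (Ico_subset_Icc_self hx)).hasDerivWithinAt (s := Ici x)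
  by_contra! hcon
  have hmem : π / 2 ∈ Icc (θ a) (θ b) := by
    rw [h.apply_left]; constructor <;> linarith [pi_pos]
  obtain ⟨x, hx, hxe⟩ := intermediate_value_Icc hab.le h.continuous.continuousOn hmem
  have := hconst x hx
  rw [hxe, h.apply_left] at this
  simp only [cos_pi_div_two, cos_zero, mul_zero, mul_one] at this
  exact (amplitude_pos A r a 0 θ a).ne this

/-- For `y ≥ 0` the integral is the time an angle of speed `cos² + k sin²` needs to go from `0` to
`y`. Dominated convergence applies: the integrand is at most `1` for `k ≥ 1` and tends to `0` off
the countable zero set of `sin`. -/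
lemma tendsto_integral_inv_cos_sq_add (y : ℝ) :
    Tendsto (fun k : ℝ => ∫ φ in (0 : ℝ)..y, (cos φ ^ 2 + k * sin φ ^ 2)⁻¹) atTop (nhds 0) := by
  have h := intervalIntegral.tendsto_integral_filter_of_dominated_convergence
    (F := fun (k : ℝ) φ => (cos φ ^ 2 + k * sin φ ^ 2)⁻¹) (f := fun _ => (0 : ℝ))
    (μ := volume) (a := 0) (b := y) (l := atTop) (bound := fun _ => 1) ?_ ?_ ?_ ?_
  · simpa using h
  · refine Eventually.of_forall fun k => Measurable.aestronglyMeasurable ?_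
    fun_prop
  · filter_upwards [eventually_ge_atTop 1] with k hk
    refine Eventually.of_forall fun φ _ => ?_
    have h1 : 1 ≤ cos φ ^ 2 + k * sin φ ^ 2 := by
      nlinarith [sin_sq_add_cos_sq φ, sq_nonneg (sin φ)]
    rw [norm_inv, norm_of_nonneg (by linarith)]
    exact inv_le_one_of_one_le₀ h1
  · exact intervalIntegrable_const
  · have hcount : {φ : ℝ | sin φ = 0}.Countable := by
      refine (countable_range fun n : ℤ => (n : ℝ) * π).mono fun φ hφ => ?_
      obtain ⟨n, hn⟩ := sin_eq_zero_iff.1 hφ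
      exact ⟨n, hn⟩
    have hae : ∀ᵐ φ : ℝ, sin φ ≠ 0 := by
      rw [ae_iff]
      simpa using hcount.measure_zero volume
    filter_upwards [hae] with φ hφ _
    have : 0 < sin φ ^ 2 := by positivity
    exact (tendsto_atTop_add_const_left _ _ (tendsto_id.atTop_mul_const this)).inv_tendsto_atTop

/-- For large `k`, an angle with `θ' ≥ α (cos² θ + k sin² θ)` passes `y` in time less than `b - a`.
-/
theorem exists_pruferAngle_right_gt (hA : Continuous A) (hr : Continuous r) (hA0 : ∀ x, 0 < A x)
    (hr0 : ∀ x, 0 < r x) (hab : a < b) {θ : ℝ → ℝ → ℝ}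
    (h : ∀ κ, IsPruferAngle A r a b κ (θ κ)) (y : ℝ) : ∃ κ, 0 < κ ∧ y < θ κ b := by
  obtain ⟨xα, hxα, hα⟩ := isCompact_Icc.exists_isMinOn (nonempty_Icc.2 hab.le) hA.continuousOn
  obtain ⟨xβ, hxβ, hβ⟩ := isCompact_Icc.exists_isMinOn (nonempty_Icc.2 hab.le) hr.continuousOn
  have hα0 := hA0 xα
  have hβ0 := hr0 xβ
  set α := A xα
  set β := r xβ
  have hpos : 0 < α * (b - a) := mul_pos hα0 (sub_pos.2 hab)
  obtain ⟨k, hk1, hk2⟩ := (((tendsto_integral_inv_cos_sq_add y).eventually (gt_mem_nhds hpos)).and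
    (eventually_ge_atTop 1)).exists
  have hden : ∀ φ : ℝ, 0 < cos φ ^ 2 + k * sin φ ^ 2 := fun φ => by
    nlinarith [sin_sq_add_cos_sq φ, sq_nonneg (sin φ)]
  have hcont : Continuous fun φ => (cos φ ^ 2 + k * sin φ ^ 2)⁻¹ :=
    Continuous.inv₀ (by fun_prop) fun φ => (hden φ).ne'
  set F : ℝ → ℝ := fun y => ∫ φ in (0 : ℝ)..y, (cos φ ^ 2 + k * sin φ ^ 2)⁻¹
  have hF : ∀ y, HasDerivAt F (cos y ^ 2 + k * sin y ^ 2)⁻¹ y := fun y =>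
    (hcont.integral_hasStrictDerivAt 0 y).hasDerivAt
  have hFmono : Monotone F := monotone_of_deriv_nonneg (fun y => (hF y).differentiableAt)
    fun y => by rw [(hF y).deriv]; exact (inv_pos.2 (hden y)).le
  -- This `κ` makes `κ r ≥ k α` on `[a, b]`, so `F ∘ θ` grows at rate at least `α`.
  refine ⟨k * α / β, by positivity, ?_⟩
  set κ := k * α / β
  by_contra! hcon
  have hθ := h κ
  have hcomp : ∀ x ∈ Icc a b, HasDerivAt (fun x => F (θ κ x)) _ x := fun x hx =>
    (hF (θ κ x)).comp x (hθ.hasDerivAt x hx)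
  have hle := (convex_Icc a b).mul_sub_le_image_sub_of_le_deriv (f := fun x => F (θ κ x)) (C := α)
    (fun x hx => (hcomp x hx).continuousAt.continuousWithinAt)
    (fun x hx => (hcomp x (interior_subset hx)).differentiableAt.differentiableWithinAt)
    (fun x hx => by
      have hx := interior_subset hx
      rw [(hcomp x hx).deriv, inv_mul_eq_div, le_div_iff₀ (hden _)]
      have h1 : α ≤ A x := hα hx
      have h2 : β ≤ r x := hβ hx
      have h3 : k * α ≤ κ * r x := by
        calc k * α = κ * β := by simp only [κ]; field_simp
          _ ≤ κ * r x := by gcongr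
      nlinarith [sq_nonneg (sin (θ κ x)), sq_nonneg (cos (θ κ x))])
    a ⟨le_rfl, hab.le⟩ b ⟨hab.le, le_rfl⟩ hab.le
  have h0 : F (θ κ a) = 0 := by simp [F, hθ.apply_left]
  have := hFmono hcon
  simp only [h0] at hle
  have hk1' : F y < α * (b - a) := hk1
  linarith

/-- The increasing angle takes each multiple of `π` strictly between `0` and `(n + 1) π` exactly
once. -/
theorem IsPruferAngle.encard_zeros (hA0 : ∀ x, 0 < A x) (hr0 : ∀ x, 0 < r x) (hκ : 0 < κ)
    (hab : a < b) (h : IsPruferAngle A r a b κ θ) (n : ℕ) (hn : θ b = (n + 1) * π) :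
    {x ∈ Ioo a b | sin (θ x) = 0}.encard = n := by
  have hmono := h.strictMonoOn hA0 hr0 hκ
  have hsub : {x ∈ Ioo a b | sin (θ x) = 0} ⊆ Icc a b := fun x hx => Ioo_subset_Icc_self hx.1
  rw [← (hmono.injOn.mono hsub).encard_image]
  have himg : θ '' {x ∈ Ioo a b | sin (θ x) = 0} =
      (fun j : ℕ => ((j : ℝ) + 1) * π) '' (Finset.range n : Set ℕ) := by
    ext y
    simp only [mem_image, mem_ofPred_eq, Finset.coe_range, mem_Iio]
    constructor
    · rintro ⟨x, ⟨hx, hs⟩, rfl⟩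
      obtain ⟨m, hm⟩ := sin_eq_zero_iff.1 hs
      have h1 := hmono ⟨le_rfl, hab.le⟩ (Ioo_subset_Icc_self hx) hx.1
      have h2 := hmono (Ioo_subset_Icc_self hx) ⟨hab.le, le_rfl⟩ hx.2
      rw [h.apply_left, ← hm] at h1
      rw [hn, ← hm] at h2
      have h3 : (0 : ℝ) < m := pos_of_mul_pos_left h1 pi_pos.le
      have h4 : (m : ℝ) < n + 1 := lt_of_mul_lt_mul_right h2 pi_pos.le
      have h3' : 0 < m := by exact_mod_cast h3
      have h4' : m < n + 1 := by exact_mod_cast h4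
      refine ⟨(m - 1).toNat, by omega, ?_⟩
      rw [← hm]
      congr 1
      have : (((m - 1).toNat : ℤ) : ℝ) = ((m - 1 : ℤ) : ℝ) := by
        rw [Int.toNat_of_nonneg (by omega)]
      push_cast at this
      rw [this]; ring
    · rintro ⟨j, hj, rfl⟩
      have hj' : (j : ℝ) < n := by exact_mod_cast hj
      have hmem : ((j : ℝ) + 1) * π ∈ Ioo (θ a) (θ b) := by
        rw [h.apply_left, hn]
        exact ⟨by positivity, by gcongr⟩
      obtain ⟨x, hx, hxe⟩ := intermediate_value_Ioo hab.le h.continuous.continuousOn hmem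
      refine ⟨x, ⟨hx, ?_⟩, hxe⟩
      rw [hxe]
      exact sin_eq_zero_iff.2 ⟨j + 1, by push_cast; ring⟩
  rw [himg, Function.Injective.encard_image, encard_coe_eq_coe_finsetCard, Finset.card_range]
  intro i j hij
  have := mul_right_cancel₀ pi_pos.ne' hij
  exact_mod_cast add_right_cancel this

end

end SturmLiouville

/-! ### Eigenvalues by shooting, and Picone's inequality -/

namespace SturmLiouville

open Real intervalIntegral

lemma eq_left_of_hasDerivAt_zero {E : Type*} [NormedAddCommGroup E] [NormedSpace ℝ E]
    [CompleteSpace E] {f : ℝ → E} {a b : ℝ} (hc : ContinuousOn f (Icc a b))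
    (hd : ∀ x ∈ Ioo a b, HasDerivAt f 0 x) {x : ℝ} (hx : x ∈ Icc a b) : f x = f a := by
  have := integral_eq_sub_of_hasDerivAt_of_le hx.1 (hc.mono (Icc_subset_Icc_right hx.2))
    (fun y hy => hd y ⟨hy.1, hy.2.trans_le hx.2⟩) (f' := fun _ => 0) intervalIntegrable_const
  simp only [intervalIntegral.integral_zero] at this
  exact (sub_eq_zero.1 this.symm)

/-- A complex solution that vanishes at the left end point is a multiple of a given real one. -/
theorem IsSolution.eq_mul_of_left_eq_zero {A r : ℝ → ℝ} {a b κ : ℝ} {W Z : ℝ → ℝ}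
    (h : IsSolution A r a b κ W Z) (hW : W a = 0) (hWZ : ∀ x, 0 < W x ^ 2 + Z x ^ 2)
    {w z : ℝ → ℂ} (hwc : ContinuousOn w (Icc a b)) (hzc : ContinuousOn z (Icc a b))
    (hw : ∀ x ∈ Ioo a b, HasDerivAt w (A x * z x) x)
    (hz : ∀ x ∈ Ioo a b, HasDerivAt z (-(κ * r x * w x)) x) (hwa : w a = 0) :
    ∃ c : ℂ, ∀ x ∈ Icc a b, w x = c * W x ∧ z x = c * Z x := by
  have hWc : Continuous fun x => (W x : ℂ) := Complex.continuous_ofReal.comp h.continuous_fst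
  have hZc : Continuous fun x => (Z x : ℂ) := Complex.continuous_ofReal.comp h.continuous_snd
  have hWd : ∀ x ∈ Ioo a b, HasDerivAt (fun x => (W x : ℂ)) (A x * Z x) x := fun x hx => by
    simpa using (h.hasDerivAt_fst x (Ioo_subset_Icc_self hx)).ofReal_comp
  have hZd : ∀ x ∈ Ioo a b, HasDerivAt (fun x => (Z x : ℂ)) (-(κ * r x * W x)) x := fun x hx => by
    simpa using (h.hasDerivAt_snd x (Ioo_subset_Icc_self hx)).ofReal_comp
  have hN : ∀ x, (W x : ℂ) ^ 2 + (Z x : ℂ) ^ 2 ≠ 0 := fun x => by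
    exact_mod_cast (hWZ x).ne'
  -- The Wronskian of the two solutions is constant and vanishes at `a`.
  have hD : ∀ x ∈ Icc a b, w x * Z x - z x * W x = 0 := by
    intro x hx
    have := eq_left_of_hasDerivAt_zero (f := fun x => w x * Z x - z x * W x) (a := a) (b := b)
      ((hwc.mul hZc.continuousOn).sub (hzc.mul hWc.continuousOn)) (fun y hy => by
        convert! ((hw y hy).mul (hZd y hy)).sub ((hz y hy).mul (hWd y hy)) using 1
        ring) hx
    simpa [hwa, hW] using this
  -- The candidate constant is the coefficient of `(w, z)` along `(W, Z)`; its derivative is a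
  -- multiple of the Wronskian.
  have hcc : ContinuousOn (fun x => (w x * W x + z x * Z x) / ((W x : ℂ) ^ 2 + (Z x : ℂ) ^ 2))
      (Icc a b) := by
    refine ContinuousOn.div ((hwc.mul hWc.continuousOn).add (hzc.mul hZc.continuousOn))
      ((hWc.pow 2).add (hZc.pow 2)).continuousOn fun x _ => hN x
  refine ⟨(w a * W a + z a * Z a) / ((W a : ℂ) ^ 2 + (Z a : ℂ) ^ 2), fun x hx => ?_⟩
  have := eq_left_of_hasDerivAt_zero hcc (fun y hy => by
        convert! (((hw y hy).mul (hWd y hy)).add ((hz y hy).mul (hZd y hy))).div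
          (((hWd y hy).pow 2).add ((hZd y hy).pow 2)) (hN y) using 1
        simp only [Pi.add_apply, Pi.mul_apply, Pi.pow_apply]
        symm
        rw [div_eq_zero_iff]
        left
        linear_combination (-(A y - κ * r y) * ((W y : ℂ) ^ 2 - (Z y : ℂ) ^ 2)) *
          hD y (Ioo_subset_Icc_self hy)) hx
  rw [← this]
  have hDx := hD x hx
  have hNx := hN x
  constructor
  · field_simp
    linear_combination (Z x : ℂ) * hDx
  · field_simp
    linear_combination (-(W x : ℂ)) * hDx

/-- The Dirichlet eigenvalues `κ k` and eigenfunctions `W k` of `(W' / A)' = -κ r W` on `[a, b]`,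
with `Z k = (W k)' / A`. -/
structure IsEigensystem (A r : ℝ → ℝ) (a b : ℝ) (κ : ℕ → ℝ) (W Z : ℕ → ℝ → ℝ) : Prop where
  strictMono : StrictMono κ
  pos : ∀ k, 0 < κ k
  tendsto : Tendsto κ atTop atTop
  isSolution : ∀ k, IsSolution A r a b (κ k) (W k) (Z k)
  left : ∀ k, W k a = 0
  right : ∀ k, W k b = 0
  sq_add_sq_pos : ∀ k x, 0 < W k x ^ 2 + Z k x ^ 2
  encard_zeros : ∀ k : ℕ, {x ∈ Ioo a b | W k x = 0}.encard = k
  eigenvalue_mem : ∀ (μ : ℝ) (w z : ℝ → ℂ), 0 < μ → ContinuousOn w (Icc a b) →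
    ContinuousOn z (Icc a b) → (∀ x ∈ Ioo a b, HasDerivAt w (A x * z x) x) →
    (∀ x ∈ Ioo a b, HasDerivAt z (-(μ * r x * w x)) x) → w a = 0 → w b = 0 →
    (∃ x ∈ Icc a b, w x ≠ 0) → ∃ k, μ = κ k

theorem exists_isEigensystem {A r : ℝ → ℝ} (hA : Continuous A) (hr : Continuous r)
    (hA0 : ∀ x, 0 < A x) (hr0 : ∀ x, 0 < r x) {a b : ℝ} (hab : a < b) :
    ∃ κ W Z, IsEigensystem A r a b κ W Z := by
  choose θ hθ using fun κ => exists_isPruferAngle hA hr hab κ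
  have hcont := continuous_pruferAngle_right hA hr hab hθ
  have hmono : StrictMono fun κ => θ κ b := fun κ₁ κ₂ h =>
    (hθ κ₁).lt_of_lt hA hr hA0 hr0 hab (hθ κ₂) h
  have hzero : θ 0 b < π := (hθ 0).lt_pi_of_zero hA hr hab
  -- The targets start at `π`: for `κ > 0` the end angle is positive, so `0` is not available.
  have hex : ∀ n : ℕ, ∃ κ, 0 < κ ∧ θ κ b = (n + 1) * π := by
    intro n
    obtain ⟨K, hK, hKb⟩ := exists_pruferAngle_right_gt hA hr hA0 hr0 hab hθ ((n + 1) * π)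
    have hmem : ((n : ℝ) + 1) * π ∈ Ioo (θ 0 b) (θ K b) := by
      refine ⟨hzero.trans_le ?_, hKb⟩
      have : (0 : ℝ) ≤ n := n.cast_nonneg
      nlinarith [pi_pos]
    obtain ⟨κ, hκ, hκe⟩ := intermediate_value_Ioo hK.le hcont.continuousOn hmem
    exact ⟨κ, hκ.1, hκe⟩
  choose κ hκ0 hκ using hex
  have hκmono : StrictMono κ := by
    intro m n hmn
    have : (fun κ => θ κ b) (κ m) < (fun κ => θ κ b) (κ n) := by
      simp only [hκ]
      have : (m : ℝ) < n := by exact_mod_cast hmn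
      gcongr
    exact hmono.lt_iff_lt.1 this
  have hWZ : ∀ μ x, (amplitude A r a μ (θ μ) x * sin (θ μ x)) ^ 2 +
      (amplitude A r a μ (θ μ) x * cos (θ μ x)) ^ 2 = amplitude A r a μ (θ μ) x ^ 2 := fun μ x => by
    linear_combination amplitude A r a μ (θ μ) x ^ 2 * sin_sq_add_cos_sq (θ μ x)
  have hsin : ∀ k : ℕ, sin (((k : ℝ) + 1) * π) = 0 := fun k => by
    exact_mod_cast sin_nat_mul_pi (k + 1)
  refine ⟨κ, fun k x => amplitude A r a (κ k) (θ (κ k)) x * sin (θ (κ k) x),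
    fun k x => amplitude A r a (κ k) (θ (κ k)) x * cos (θ (κ k) x),
    hκmono, hκ0, ?_, fun k => (hθ (κ k)).isSolution hA hr, fun k => ?_, fun k => ?_,
    fun k x => ?_, fun k => ?_, ?_⟩
  -- If `κ n < K` then `(n + 1) π < θ K b`, which fails once `n ≥ θ K b / π`.
  · refine tendsto_atTop_atTop_of_monotone hκmono.monotone fun K => ?_
    obtain ⟨n, hn⟩ := exists_nat_ge (θ K b / π)
    refine ⟨n, ?_⟩
    by_contra! hlt
    have h1 := hmono hlt
    simp only [hκ] at h1
    rw [div_le_iff₀ pi_pos] at hn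
    nlinarith [pi_pos]
  · simp [(hθ (κ k)).apply_left]
  · simp [hκ k, hsin]
  · simp only [hWZ]
    have := amplitude_pos A r a (κ k) (θ (κ k)) x
    positivity
  · rw [← (hθ (κ k)).encard_zeros hA0 hr0 (hκ0 k) hab k (hκ k)]
    congr 1
    ext x
    simp [(amplitude_pos A r a (κ k) (θ (κ k)) x).ne']
  · intro μ w z hμ hwc hzc hw hz hwa hwb ⟨x, hx, hwx⟩
    obtain ⟨c, hc⟩ := ((hθ μ).isSolution hA hr).eq_mul_of_left_eq_zero (by simp [(hθ μ).apply_left])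
      (fun x => by
        rw [hWZ]
        have := amplitude_pos A r a μ (θ μ) x
        positivity) hwc hzc hw hz hwa
    have hc0 : c ≠ 0 := by
      rintro rfl
      exact hwx (by simpa using (hc x hx).1)
    have hb := (hc b ⟨hab.le, le_rfl⟩).1
    rw [hwb] at hb
    have hs : sin (θ μ b) = 0 := by
      have h1 := (mul_eq_zero.1 hb.symm).resolve_left hc0
      have h2 : amplitude A r a μ (θ μ) b * sin (θ μ b) = 0 := by exact_mod_cast h1
      exact (mul_eq_zero.1 h2).resolve_left (amplitude_pos A r a μ (θ μ) b).ne'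
    obtain ⟨m, hm⟩ := sin_eq_zero_iff.1 hs
    have hpos := (hθ μ).strictMonoOn hA0 hr0 hμ ⟨le_rfl, hab.le⟩ ⟨hab.le, le_rfl⟩ hab
    rw [(hθ μ).apply_left, ← hm] at hpos
    have hm0 : 0 < m := by exact_mod_cast pos_of_mul_pos_left hpos pi_pos.le
    refine ⟨(m - 1).toNat, hmono.injective ?_⟩
    simp only [hκ]
    rw [← hm]
    congr 1
    have : (((m - 1).toNat : ℤ) : ℝ) = ((m - 1 : ℤ) : ℝ) := by
      rw [Int.toNat_of_nonneg (by omega)]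
    push_cast at this
    rw [this]; ring

/-- **Picone's inequality**: a function that vanishes wherever the solution `W` does satisfies the
Rayleigh bound. -/
theorem IsSolution.mul_integral_sq_le {A r : ℝ → ℝ} {a b κ : ℝ} {W Z : ℝ → ℝ}
    (h : IsSolution A r a b κ W Z) (hA : Continuous A) (hr : Continuous r) (hA0 : ∀ x, 0 < A x)
    (hab : a ≤ b) (hWa : W a = 0) (hWb : W b = 0) (hWZ : ∀ x, 0 < W x ^ 2 + Z x ^ 2)
    {y y' : ℝ → ℝ} (hy : Continuous y) (hy' : Continuous y')
    (hd : ∀ x ∈ Icc a b, HasDerivAt y (y' x) x) (hzero : ∀ x ∈ Icc a b, W x = 0 → y x = 0) :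
    κ * ∫ x in a..b, r x * y x ^ 2 ≤ ∫ x in a..b, y' x ^ 2 / A x := by
  have hA1 : ∀ x, A x ≠ 0 := fun x => (hA0 x).ne'
  -- Away from zeros of `W`, `(y² Z / W)' = y'² / A - κ r y² - (y' - A y Z / W)² / A`.
  have key : ∀ x ∈ Icc a b, ∃ g, HasDerivAt (fun x => y x ^ 2 * Z x / W x) g x ∧
      g ≤ y' x ^ 2 / A x - κ * (r x * y x ^ 2) := by
    intro x hx
    have hAx := hA0 x
    by_cases hWx : W x = 0
    -- At a zero of `W` division by zero gives the quotient the value `0`. This is its limit: `W`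
    -- has a simple zero because `Z ≠ 0`, and `y²` vanishes to second order. The slope tends to `y'²
    -- / A`.
    · have hyx := hzero x hx hWx
      have hZx : Z x ≠ 0 := by
        intro h0
        have := hWZ x
        simp [hWx, h0] at this
      refine ⟨y' x ^ 2 / A x, ?_, by simp [hyx]⟩
      rw [hasDerivAt_iff_tendsto_slope]
      have h1 := hasDerivAt_iff_tendsto_slope.1 (hd x hx)
      have h2 := hasDerivAt_iff_tendsto_slope.1 (h.hasDerivAt_fst x hx)
      have h3 : Tendsto Z (nhdsWithin x {x}ᶜ) (nhds (Z x)) :=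
        (h.continuous_snd.tendsto x).mono_left nhdsWithin_le_nhds
      have h4 := ((h1.pow 2).mul h3).div h2 (mul_ne_zero hAx.ne' hZx)
      have he : y' x ^ 2 * Z x / (A x * Z x) = y' x ^ 2 / A x := by field_simp
      rw [he] at h4
      refine h4.congr' ?_
      filter_upwards [self_mem_nhdsWithin] with t ht
      have ht' : t - x ≠ 0 := sub_ne_zero.2 ht
      simp only [Pi.div_apply, slope_def_field, hWx, hyx, sub_zero]
      by_cases hWt : W t = 0
      · simp [hWt]
      · field_simp
        ring
    · refine ⟨_, (((hd x hx).pow 2).mul (h.hasDerivAt_snd x hx)).div (h.hasDerivAt_fst x hx) hWx, ?_⟩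
      simp only [Pi.mul_apply, Pi.pow_apply]
      rw [← sub_nonneg]
      have : 0 ≤ (y' x - A x * y x * Z x / W x) ^ 2 / A x := by positivity
      refine this.trans_eq ?_
      have := hA1 x
      field_simp
      ring
  choose! g hg hgle using key
  have hcont : ContinuousOn (fun x => y x ^ 2 * Z x / W x) (Icc a b) := fun x hx =>
    (hg x hx).continuousAt.continuousWithinAt
  have hc1 : Continuous fun x => y' x ^ 2 / A x := (hy'.pow 2).div hA hA1
  have hc2 : Continuous fun x => κ * (r x * y x ^ 2) := by fun_prop
  have := sub_le_integral_of_hasDeriv_right_of_le hab hcont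
    (fun x hx => (hg x (Ioo_subset_Icc_self hx)).hasDerivWithinAt)
    ((hc1.sub hc2).continuousOn.integrableOn_Icc)
    (fun x hx => hgle x (Ioo_subset_Icc_self hx))
  -- The boundary terms are `0` by the same convention.
  simp only [hWa, hWb, div_zero, sub_zero, Pi.sub_apply] at this
  rw [intervalIntegral.integral_sub (hc1.intervalIntegrable _ _) (hc2.intervalIntegrable _ _),
    intervalIntegral.integral_const_mul] at this
  linarith

end SturmLiouville

/-! ### Orthogonality, Rayleigh bound and Fourier remainder -/

namespace SturmLiouville

open Real intervalIntegral

namespace IsEigensystem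

variable {A r : ℝ → ℝ} {a b : ℝ} {κ : ℕ → ℝ} {W Z : ℕ → ℝ → ℝ}

lemma continuous_fst (h : IsEigensystem A r a b κ W Z) (k : ℕ) : Continuous (W k) :=
  (h.isSolution k).continuous_fst

lemma continuous_snd (h : IsEigensystem A r a b κ W Z) (k : ℕ) : Continuous (Z k) :=
  (h.isSolution k).continuous_snd

/-- Integration by parts against an eigenfunction. -/
theorem integral_deriv_mul (h : IsEigensystem A r a b κ W Z) (hr : Continuous r) (hab : a ≤ b)
    {u u' : ℝ → ℝ} (hu : Continuous u) (hu' : Continuous u')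
    (hd : ∀ x ∈ Icc a b, HasDerivAt u (u' x) x) (hua : u a = 0) (hub : u b = 0) (k : ℕ) :
    ∫ x in a..b, u' x * Z k x = κ k * ∫ x in a..b, r x * u x * W k x := by
  have hW := h.continuous_fst k
  have hZ := h.continuous_snd k
  have hc1 : Continuous fun x => u' x * Z k x := by fun_prop
  have hc2 : Continuous fun x => κ k * (r x * u x * W k x) := by fun_prop
  have := integral_eq_sub_of_hasDerivAt (a := a) (b := b) (f := fun x => u x * Z k x)
    (f' := fun x => u' x * Z k x - κ k * (r x * u x * W k x)) (fun x hx => by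
      rw [uIcc_of_le hab] at hx
      convert! (hd x hx).mul ((h.isSolution k).hasDerivAt_snd x hx) using 1
      ring) ((hc1.sub hc2).intervalIntegrable _ _)
  rw [intervalIntegral.integral_sub (hc1.intervalIntegrable _ _) (hc2.intervalIntegrable _ _),
    intervalIntegral.integral_const_mul] at this
  simp only [hua, hub] at this
  linarith

/-- The symmetric form `∫ A Z_j Z_k` equals both `κ_j` and `κ_k` times the integral, and `κ_j ≠
κ_k`. -/
theorem integral_mul_eq_zero (h : IsEigensystem A r a b κ W Z) (hA : Continuous A)
    (hr : Continuous r) (hab : a ≤ b) {j k : ℕ} (hjk : j ≠ k) :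
    ∫ x in a..b, r x * W j x * W k x = 0 := by
  have h1 := h.integral_deriv_mul hr hab (h.continuous_fst j) (hA.mul (h.continuous_snd j))
    (h.isSolution j).hasDerivAt_fst (h.left j) (h.right j) k
  have h2 := h.integral_deriv_mul hr hab (h.continuous_fst k) (hA.mul (h.continuous_snd k))
    (h.isSolution k).hasDerivAt_fst (h.left k) (h.right k) j
  have e1 : ∫ x in a..b, A x * Z k x * Z j x = ∫ x in a..b, A x * Z j x * Z k x := by
    congr 1; ext x; ring
  have e2 : ∫ x in a..b, r x * W k x * W j x = ∫ x in a..b, r x * W j x * W k x := by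
    congr 1; ext x; ring
  simp only [Pi.mul_apply] at h1 h2
  rw [e1, e2, h1] at h2
  have h3 : (κ j - κ k) * ∫ x in a..b, r x * W j x * W k x = 0 := by linarith
  exact (mul_eq_zero.1 h3).resolve_left (sub_ne_zero.2 (h.strictMono.injective.ne hjk))

theorem integral_sq_pos (h : IsEigensystem A r a b κ W Z) (hr : Continuous r) (hr0 : ∀ x, 0 < r x) (hab : a < b) (k : ℕ) :
    0 < ∫ x in a..b, r x * W k x ^ 2 := by
  have hW := h.continuous_fst k
  obtain ⟨x, hx, hWx⟩ : ∃ x ∈ Ioo a b, W k x ≠ 0 := by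
    by_contra! hcon
    have heq : {x ∈ Ioo a b | W k x = 0} = Ioo a b := by
      ext x
      exact ⟨fun hx => hx.1, fun hx => ⟨hx, hcon x hx⟩⟩
    have := h.encard_zeros k
    rw [heq, (Ioo_infinite hab).encard_eq] at this
    exact ENat.top_ne_natCast k this
  refine intervalIntegral.integral_pos hab (by fun_prop) (fun y _ => ?_)
    ⟨x, Ioo_subset_Icc_self hx, ?_⟩
  · have := (hr0 y).le
    positivity
  · have := hr0 x
    positivity

section Sums

variable (s : Finset ℕ) (c : ℕ → ℝ)

lemma integral_mul_sum (h : IsEigensystem A r a b κ W Z) (hr : Continuous r) {u : ℝ → ℝ}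
    (hu : Continuous u) :
    ∫ x in a..b, r x * u x * ∑ k ∈ s, c k * W k x =
      ∑ k ∈ s, c k * ∫ x in a..b, r x * u x * W k x := by
  have hW := h.continuous_fst
  simp only [Finset.mul_sum, ← intervalIntegral.integral_const_mul]
  rw [← intervalIntegral.integral_finsetSum fun k _ =>
    (by fun_prop : Continuous fun x => c k * (r x * u x * W k x)).intervalIntegrable _ _]
  congr 1; ext x
  exact Finset.sum_congr rfl fun k _ => by ring

lemma integral_deriv_mul_sum (h : IsEigensystem A r a b κ W Z) (hr : Continuous r) (hab : a ≤ b)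
    {u u' : ℝ → ℝ} (hu : Continuous u) (hu' : Continuous u')
    (hd : ∀ x ∈ Icc a b, HasDerivAt u (u' x) x) (hua : u a = 0) (hub : u b = 0) :
    ∫ x in a..b, u' x * ∑ k ∈ s, c k * Z k x =
      ∑ k ∈ s, c k * (κ k * ∫ x in a..b, r x * u x * W k x) := by
  have hZ := h.continuous_snd
  simp only [← h.integral_deriv_mul hr hab hu hu' hd hua hub]
  simp only [Finset.mul_sum, ← intervalIntegral.integral_const_mul]
  rw [← intervalIntegral.integral_finsetSum fun k _ =>
    (by fun_prop : Continuous fun x => c k * (u' x * Z k x)).intervalIntegrable _ _]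
  congr 1; ext x
  exact Finset.sum_congr rfl fun k _ => by ring

lemma integral_sum_mul (h : IsEigensystem A r a b κ W Z) (hA : Continuous A)
    (hr : Continuous r) (hab : a ≤ b) {j : ℕ} (hj : j ∈ s) :
    ∫ x in a..b, r x * (∑ k ∈ s, c k * W k x) * W j x =
      c j * ∫ x in a..b, r x * W j x ^ 2 := by
  have e : ∫ x in a..b, r x * (∑ k ∈ s, c k * W k x) * W j x =
      ∫ x in a..b, r x * W j x * ∑ k ∈ s, c k * W k x := by
    congr 1; ext x; ring
  rw [e, h.integral_mul_sum s c hr (h.continuous_fst j), Finset.sum_eq_single_of_mem j hj]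
  · congr 2; ext x; ring
  · intro k _ hkj
    rw [h.integral_mul_eq_zero hA hr hab hkj.symm, mul_zero]

lemma hasDerivAt_sum (h : IsEigensystem A r a b κ W Z) {x : ℝ} (hx : x ∈ Icc a b) :
    HasDerivAt (fun x => ∑ k ∈ s, c k * W k x) (A x * ∑ k ∈ s, c k * Z k x) x := by
  have := HasDerivAt.fun_sum fun k (_ : k ∈ s) =>
    ((h.isSolution k).hasDerivAt_fst x hx).const_mul (c k)
  convert! this using 1
  rw [Finset.mul_sum]
  exact Finset.sum_congr rfl fun k _ => by ring

lemma sum_eq_zero_left (h : IsEigensystem A r a b κ W Z) : ∑ k ∈ s, c k * W k a = 0 :=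
  Finset.sum_eq_zero fun k _ => by rw [h.left, mul_zero]

lemma sum_eq_zero_right (h : IsEigensystem A r a b κ W Z) : ∑ k ∈ s, c k * W k b = 0 :=
  Finset.sum_eq_zero fun k _ => by rw [h.right, mul_zero]

lemma integral_sum_sq (h : IsEigensystem A r a b κ W Z) (hA : Continuous A)
    (hr : Continuous r) (hab : a ≤ b) :
    ∫ x in a..b, r x * (∑ k ∈ s, c k * W k x) ^ 2 =
      ∑ k ∈ s, c k ^ 2 * ∫ x in a..b, r x * W k x ^ 2 := by
  have hW := h.continuous_fst
  have e : ∫ x in a..b, r x * (∑ k ∈ s, c k * W k x) ^ 2 =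
      ∫ x in a..b, r x * (∑ k ∈ s, c k * W k x) * ∑ k ∈ s, c k * W k x := by
    congr 1; ext x; ring
  rw [e, h.integral_mul_sum s c hr (by fun_prop)]
  refine Finset.sum_congr rfl fun k hk => ?_
  rw [h.integral_sum_mul s c hA hr hab hk]
  ring

lemma integral_deriv_sum_sq (h : IsEigensystem A r a b κ W Z) (hA : Continuous A)
    (hr : Continuous r) (hab : a ≤ b) :
    ∫ x in a..b, A x * (∑ k ∈ s, c k * Z k x) ^ 2 =
      ∑ k ∈ s, c k ^ 2 * (κ k * ∫ x in a..b, r x * W k x ^ 2) := by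
  have hW := h.continuous_fst
  have hZ := h.continuous_snd
  have e : ∫ x in a..b, A x * (∑ k ∈ s, c k * Z k x) ^ 2 =
      ∫ x in a..b, A x * (∑ k ∈ s, c k * Z k x) * ∑ k ∈ s, c k * Z k x := by
    congr 1; ext x; ring
  rw [e, h.integral_deriv_mul_sum s c hr hab (u := fun x => ∑ k ∈ s, c k * W k x) (by fun_prop)
    (by fun_prop) (fun x hx => h.hasDerivAt_sum s c hx) (h.sum_eq_zero_left s c)
    (h.sum_eq_zero_right s c)]
  refine Finset.sum_congr rfl fun k hk => ?_
  rw [h.integral_sum_mul s c hA hr hab hk]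
  ring

end Sums

/-- A nontrivial combination of `u` and the first `n` eigenfunctions that vanishes at the interior
zeros of eigenfunction number `n`. -/
lemma exists_combination_eq_zero (h : IsEigensystem A r a b κ W Z) (u : ℝ → ℝ) (n : ℕ) :
    ∃ (t : ℝ) (c : ℕ → ℝ), (t ≠ 0 ∨ ∃ k < n, c k ≠ 0) ∧
      ∀ x ∈ Ioo a b, W n x = 0 → t * u x + ∑ k ∈ Finset.range n, c k * W k x = 0 := by
  classical
  have hfin : {x ∈ Ioo a b | W n x = 0}.Finite := finite_of_encard_eq_coe (h.encard_zeros n)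
  set S := hfin.toFinset with hS
  have hcard : S.card = n := by
    have h1 := h.encard_zeros n
    rw [hfin.encard_eq_coe_toFinset_card] at h1
    exact_mod_cast h1
  -- One linear condition per zero: `n` equations in `n + 1` unknowns, the last unknown multiplying
  -- `u`.
  let M : Matrix S (Fin (n + 1)) ℝ := Matrix.of fun x =>
    Fin.snoc (α := fun _ => ℝ) (fun i : Fin n => W i x) (u x)
  have hker : LinearMap.ker M.mulVecLin ≠ ⊥ := by
    apply LinearMap.ker_ne_bot_of_finrank_lt
    simp [hcard]
  obtain ⟨v, hv, hv0⟩ := Submodule.exists_mem_ne_zero_of_ne_bot hker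
  refine ⟨v (Fin.last n), fun k => if hk : k < n then v (Fin.castSucc ⟨k, hk⟩) else 0, ?_, ?_⟩
  · by_contra! hcon
    obtain ⟨ht, hc⟩ := hcon
    apply hv0
    ext i
    refine Fin.lastCases ht (fun i => ?_) i
    simpa using hc i i.2
  · intro x hx hWx
    have hxS : x ∈ S := by
      rw [hS, Set.Finite.mem_toFinset]
      exact ⟨hx, hWx⟩
    have hvx : (M.mulVec v) ⟨x, hxS⟩ = 0 := congrFun (LinearMap.mem_ker.1 hv) ⟨x, hxS⟩
    simp only [Matrix.mulVec, dotProduct, M, Matrix.of_apply, Fin.sum_univ_castSucc,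
      Fin.snoc_castSucc, Fin.snoc_last] at hvx
    rw [Finset.sum_range, ← hvx, add_comm, mul_comm]
    congr 1
    exact Finset.sum_congr rfl fun i _ => by simp [mul_comm]

/-- The Rayleigh bound on the orthogonal complement of the first `n` eigenfunctions. -/
theorem mul_integral_sq_le_of_orthogonal (h : IsEigensystem A r a b κ W Z) (hA : Continuous A)
    (hr : Continuous r) (hA0 : ∀ x, 0 < A x) (hr0 : ∀ x, 0 < r x) (hab : a < b)
    {u u' : ℝ → ℝ} (hu : Continuous u) (hu' : Continuous u')
    (hd : ∀ x ∈ Icc a b, HasDerivAt u (u' x) x) (hua : u a = 0) (hub : u b = 0) (n : ℕ)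
    (horth : ∀ k < n, ∫ x in a..b, r x * u x * W k x = 0) :
    κ n * ∫ x in a..b, r x * u x ^ 2 ≤ ∫ x in a..b, u' x ^ 2 / A x := by
  obtain ⟨t, c, hne, hzero⟩ := h.exists_combination_eq_zero u n
  have hW := h.continuous_fst
  have hZ := h.continuous_snd
  have hA1 : ∀ x, A x ≠ 0 := fun x => (hA0 x).ne'
  set s := Finset.range n
  have hPic := (h.isSolution n).mul_integral_sq_le hA hr hA0 hab.le (h.left n) (h.right n)
    (h.sq_add_sq_pos n) (y := fun x => t * u x + ∑ k ∈ s, c k * W k x)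
    (y' := fun x => t * u' x + A x * ∑ k ∈ s, c k * Z k x) (by fun_prop) (by fun_prop)
    (fun x hx => ((hd x hx).const_mul t).add (h.hasDerivAt_sum s c hx))
    (fun x hx hWx => by
      rcases eq_or_lt_of_le hx.1 with rfl | hax
      · simp [hua, h.sum_eq_zero_left s c]
      rcases eq_or_lt_of_le hx.2 with rfl | hxb
      · simp [hub, h.sum_eq_zero_right s c]
      exact hzero x ⟨hax, hxb⟩ hWx)
  have hc1 : Continuous fun x => r x * u x ^ 2 := by fun_prop
  have hc2 : Continuous fun x => r x * u x * ∑ k ∈ s, c k * W k x := by fun_prop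
  have hc3 : Continuous fun x => r x * (∑ k ∈ s, c k * W k x) ^ 2 := by fun_prop
  have hc4 : Continuous fun x => u' x ^ 2 / A x := (hu'.pow 2).div hA hA1
  have hc5 : Continuous fun x => u' x * ∑ k ∈ s, c k * Z k x := by fun_prop
  have hc6 : Continuous fun x => A x * (∑ k ∈ s, c k * Z k x) ^ 2 := by fun_prop
  have hL : ∫ x in a..b, r x * (t * u x + ∑ k ∈ s, c k * W k x) ^ 2 =
      t ^ 2 * (∫ x in a..b, r x * u x ^ 2) + 2 * t * (∫ x in a..b, r x * u x *
        ∑ k ∈ s, c k * W k x) + ∫ x in a..b, r x * (∑ k ∈ s, c k * W k x) ^ 2 := by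
    rw [← intervalIntegral.integral_const_mul, ← intervalIntegral.integral_const_mul,
      ← intervalIntegral.integral_add, ← intervalIntegral.integral_add]
    · congr 1; ext x; ring
    all_goals exact Continuous.intervalIntegrable (by fun_prop) _ _
  have hR : ∫ x in a..b, (t * u' x + A x * ∑ k ∈ s, c k * Z k x) ^ 2 / A x =
      t ^ 2 * (∫ x in a..b, u' x ^ 2 / A x) + 2 * t * (∫ x in a..b, u' x *
        ∑ k ∈ s, c k * Z k x) + ∫ x in a..b, A x * (∑ k ∈ s, c k * Z k x) ^ 2 := by
    rw [← intervalIntegral.integral_const_mul, ← intervalIntegral.integral_const_mul,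
      ← intervalIntegral.integral_add, ← intervalIntegral.integral_add]
    · congr 1; ext x
      have := hA1 x
      field_simp
      ring
    all_goals exact Continuous.intervalIntegrable (by fun_prop) _ _
  -- Both cross terms vanish because `u` is orthogonal to the first `n` eigenfunctions.
  have hx1 : ∫ x in a..b, r x * u x * ∑ k ∈ s, c k * W k x = 0 := by
    rw [h.integral_mul_sum s c hr hu]
    exact Finset.sum_eq_zero fun k hk => by rw [horth k (Finset.mem_range.1 hk), mul_zero]
  have hx2 : ∫ x in a..b, u' x * ∑ k ∈ s, c k * Z k x = 0 := by
    rw [h.integral_deriv_mul_sum s c hr hab.le hu hu' hd hua hub]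
    exact Finset.sum_eq_zero fun k hk => by
      rw [horth k (Finset.mem_range.1 hk), mul_zero, mul_zero]
  rw [hL, hR, hx1, hx2, h.integral_sum_sq s c hA hr hab.le,
    h.integral_deriv_sum_sq s c hA hr hab.le] at hPic
  have hdiff : κ n * ∑ k ∈ s, c k ^ 2 * (∫ x in a..b, r x * W k x ^ 2) -
      ∑ k ∈ s, c k ^ 2 * (κ k * ∫ x in a..b, r x * W k x ^ 2) =
      ∑ k ∈ s, (κ n - κ k) * (c k ^ 2 * ∫ x in a..b, r x * W k x ^ 2) := by
    rw [Finset.mul_sum, ← Finset.sum_sub_distrib]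
    exact Finset.sum_congr rfl fun k _ => by ring
  have hterm : ∀ k ∈ s, 0 ≤ (κ n - κ k) * (c k ^ 2 * ∫ x in a..b, r x * W k x ^ 2) := by
    intro k hk
    have h1 := h.integral_sq_pos hr hr0 hab k
    have h2 : 0 < κ n - κ k := sub_pos.2 (h.strictMono (Finset.mem_range.1 hk))
    positivity
  have hsum := Finset.sum_nonneg hterm
  -- With `t = 0`, Picone's inequality would force the sum of `(κ n - κ k) c_k² ∫ r W_k²` to be
  -- nonpositive, though some `c_k ≠ 0`.
  have ht : t ≠ 0 := by
    rintro rfl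
    obtain ⟨k, hk, hck⟩ := hne.resolve_left (by simp)
    have hpos : 0 < ∑ k ∈ s, (κ n - κ k) * (c k ^ 2 * ∫ x in a..b, r x * W k x ^ 2) := by
      refine Finset.sum_pos' hterm ⟨k, Finset.mem_range.2 hk, ?_⟩
      have h1 := h.integral_sq_pos hr hr0 hab k
      have h2 : 0 < κ n - κ k := sub_pos.2 (h.strictMono hk)
      positivity
    linarith
  have ht2 : 0 < t ^ 2 := by positivity
  refine le_of_mul_le_mul_left ?_ ht2
  linarith

/-- The Fourier remainder of order `n` of a function with finite energy. -/
theorem exists_mul_integral_sub_sq_le (h : IsEigensystem A r a b κ W Z) (hA : Continuous A)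
    (hr : Continuous r) (hA0 : ∀ x, 0 < A x) (hr0 : ∀ x, 0 < r x) (hab : a < b)
    {u u' : ℝ → ℝ} (hu : Continuous u) (hu' : Continuous u')
    (hd : ∀ x ∈ Icc a b, HasDerivAt u (u' x) x) (hua : u a = 0) (hub : u b = 0) (n : ℕ) :
    ∃ c : ℕ → ℝ, κ n * ∫ x in a..b, r x * (u x - ∑ k ∈ Finset.range n, c k * W k x) ^ 2 ≤
      ∫ x in a..b, u' x ^ 2 / A x := by
  have hW := h.continuous_fst
  have hZ := h.continuous_snd
  have hA1 : ∀ x, A x ≠ 0 := fun x => (hA0 x).ne'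
  have hN := fun k => (h.integral_sq_pos hr hr0 hab k)
  set s := Finset.range n
  set c : ℕ → ℝ := fun k => (∫ x in a..b, r x * u x * W k x) / ∫ x in a..b, r x * W k x ^ 2
  have hc : ∀ k, ∫ x in a..b, r x * u x * W k x = c k * ∫ x in a..b, r x * W k x ^ 2 := fun k =>
    (div_mul_cancel₀ _ (hN k).ne').symm
  refine ⟨c, ?_⟩
  have hRay := h.mul_integral_sq_le_of_orthogonal hA hr hA0 hr0 hab
    (u := fun x => u x - ∑ k ∈ s, c k * W k x) (u' := fun x => u' x - A x * ∑ k ∈ s, c k * Z k x)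
    (by fun_prop) (by fun_prop) (fun x hx => (hd x hx).sub (h.hasDerivAt_sum s c hx))
    (by simp [hua, h.sum_eq_zero_left s c]) (by simp [hub, h.sum_eq_zero_right s c]) n
    (fun k hk => by
      have e : ∫ x in a..b, r x * (u x - ∑ k ∈ s, c k * W k x) * W k x =
          (∫ x in a..b, r x * u x * W k x) -
            ∫ x in a..b, r x * (∑ k ∈ s, c k * W k x) * W k x := by
        rw [← intervalIntegral.integral_sub]
        · congr 1; ext x; ring
        all_goals exact Continuous.intervalIntegrable (by fun_prop) _ _
      rw [e, h.integral_sum_mul s c hA hr hab.le (Finset.mem_range.2 hk), hc k, sub_self])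
  refine hRay.trans ?_
  have hc4 : Continuous fun x => u' x ^ 2 / A x := (hu'.pow 2).div hA hA1
  have hR : ∫ x in a..b, (u' x - A x * ∑ k ∈ s, c k * Z k x) ^ 2 / A x =
      (∫ x in a..b, u' x ^ 2 / A x) - 2 * (∫ x in a..b, u' x *
        ∑ k ∈ s, c k * Z k x) + ∫ x in a..b, A x * (∑ k ∈ s, c k * Z k x) ^ 2 := by
    rw [← intervalIntegral.integral_const_mul,
      ← intervalIntegral.integral_sub, ← intervalIntegral.integral_add]
    · congr 1; ext x
      have := hA1 x
      field_simp
      ring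
    all_goals exact Continuous.intervalIntegrable (by fun_prop) _ _
  rw [hR, h.integral_deriv_mul_sum s c hr hab.le hu hu' hd hua hub,
    h.integral_deriv_sum_sq s c hA hr hab.le]
  -- Bessel's argument in the energy: that of the remainder is the energy of `u` minus a nonnegative
  -- sum.
  have e : ∑ k ∈ s, c k * (κ k * ∫ x in a..b, r x * u x * W k x) =
      ∑ k ∈ s, c k ^ 2 * (κ k * ∫ x in a..b, r x * W k x ^ 2) :=
    Finset.sum_congr rfl fun k _ => by rw [hc k]; ring
  have hnn : 0 ≤ ∑ k ∈ s, c k ^ 2 * (κ k * ∫ x in a..b, r x * W k x ^ 2) :=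
    Finset.sum_nonneg fun k _ => by
      have h1 := hN k
      have h2 := h.pos k
      positivity
  rw [e]
  linarith

end IsEigensystem

end SturmLiouville

/-! ### Completeness in the weighted space -/

namespace SturmLiouville

open Real

section WeightMeasure

open Metastab

variable {r : ℝ → ℝ} {ℓ C : ℝ} {wt : ℝ → ℝ}

lemma weightMeasure_eq (hwt : ∀ x ∈ Ioo (-ℓ) ℓ, wt x = C / r x) :
    weightMeasure ℓ wt = weightMeasure ℓ fun x => C / r x := by
  refine withDensity_congr_ae ?_
  filter_upwards [ae_restrict_mem measurableSet_Ioo] with x hx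
  rw [hwt x hx]

lemma isFiniteMeasure_weightMeasure {ρ : ℝ → ℝ} (hρ : Continuous ρ) :
    IsFiniteMeasure (weightMeasure ℓ ρ) := by
  refine isFiniteMeasure_withDensity_ofReal ?_
  exact (hρ.continuousOn.integrableOn_Icc.mono_set Ioo_subset_Icc_self).2

lemma memLp_weightMeasure {ρ f : ℝ → ℝ} (hρ : Continuous ρ) (hf : Continuous f) (p : ENNReal) :
    MemLp f p (weightMeasure ℓ ρ) := by
  have := isFiniteMeasure_weightMeasure (ℓ := ℓ) hρ
  obtain ⟨M, hM⟩ := (isCompact_Icc (a := -ℓ) (b := ℓ)).exists_bound_of_continuousOn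
    hf.continuousOn
  refine MemLp.of_bound hf.aestronglyMeasurable M ?_
  refine (withDensity_absolutelyContinuous _ _).ae_le ?_
  filter_upwards [ae_restrict_mem measurableSet_Ioo] with x hx
  exact hM x (Ioo_subset_Icc_self hx)

lemma integral_weightMeasure {ρ : ℝ → ℝ} (hρ : Continuous ρ) (hρ0 : ∀ x, 0 < ρ x) (f : ℝ → ℝ) :
    ∫ x, f x ∂(weightMeasure ℓ ρ) = ∫ x in Ioo (-ℓ) ℓ, ρ x * f x := by
  rw [weightMeasure, integral_withDensity_eq_integral_toReal_smul (by fun_prop) (by simp)]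
  refine integral_congr_ae (Eventually.of_forall fun x => ?_)
  simp [ENNReal.toReal_ofReal (hρ0 x).le]

lemma inner_toLp_weightMeasure {ρ f : ℝ → ℝ} (hρ : Continuous ρ) (hρ0 : ∀ x, 0 < ρ x)
    (hf : MemLp f 2 (weightMeasure ℓ ρ)) (g : Lp ℝ 2 (weightMeasure ℓ ρ)) :
    inner ℝ (hf.toLp f) g = ∫ x in Ioo (-ℓ) ℓ, ρ x * (f x * g x) := by
  rw [L2.inner_def, ← integral_weightMeasure hρ hρ0]
  refine integral_congr_ae ?_
  filter_upwards [hf.coeFn_toLp] with x hx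
  simp [hx, mul_comm]

lemma inner_toLp_toLp_weightMeasure {ρ f g : ℝ → ℝ} (hℓ : 0 < ℓ) (hρ : Continuous ρ)
    (hρ0 : ∀ x, 0 < ρ x)
    (hf : MemLp f 2 (weightMeasure ℓ ρ)) (hg : MemLp g 2 (weightMeasure ℓ ρ)) :
    inner ℝ (hf.toLp f) (hg.toLp g) = ∫ x in (-ℓ)..ℓ, ρ x * (f x * g x) := by
  rw [L2.inner_def, intervalIntegral.integral_of_le (by linarith), integral_Ioc_eq_integral_Ioo,
    ← integral_weightMeasure hρ hρ0]
  refine integral_congr_ae ?_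
  filter_upwards [hf.coeFn_toLp, hg.coeFn_toLp] with x hx hx'
  simp [hx, hx', mul_comm]

/-- The weight is bounded below on the compact interval. This permits testing against smooth
functions in Lebesgue measure. -/
lemma integrableOn_of_memLp_weightMeasure {ρ : ℝ → ℝ} (hρ : Continuous ρ) (hρ0 : ∀ x, 0 < ρ x)
    {g : ℝ → ℝ} (hg : MemLp g 2 (weightMeasure ℓ ρ)) : IntegrableOn g (Ioo (-ℓ) ℓ) := by
  have := isFiniteMeasure_weightMeasure (ℓ := ℓ) hρ
  have h1 : Integrable g (weightMeasure ℓ ρ) := hg.integrable (by norm_num)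
  rw [weightMeasure, integrable_withDensity_iff_integrable_smul' (by fun_prop) (by simp)] at h1
  have hinv : Continuous fun x => (ρ x)⁻¹ := hρ.inv₀ fun x => (hρ0 x).ne'
  obtain ⟨M, hM⟩ := (isCompact_Icc (a := -ℓ) (b := ℓ)).exists_bound_of_continuousOn
    hinv.continuousOn
  have h2 := h1.bdd_mul (c := M) (f := fun x => (ρ x)⁻¹) hinv.aestronglyMeasurable (by
    filter_upwards [ae_restrict_mem measurableSet_Ioo] with x hx
    exact hM x (Ioo_subset_Icc_self hx))
  refine h2.congr (Eventually.of_forall fun x => ?_)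
  have := (hρ0 x).ne'
  simp [ENNReal.toReal_ofReal (hρ0 x).le, this]

/-- The functions `r W k` form an orthogonal basis of `L²` with the weight `C / r`. -/
theorem IsEigensystem.isOrthogonalBasisL2 {A : ℝ → ℝ} {κ : ℕ → ℝ} {W Z : ℕ → ℝ → ℝ}
    (hℓ : 0 < ℓ) (h : IsEigensystem A r (-ℓ) ℓ κ W Z) (hA : Continuous A)
    (hr : Continuous r) (hA0 : ∀ x, 0 < A x) (hr0 : ∀ x, 0 < r x) (hC : 0 < C)
    (hwt : ∀ x ∈ Ioo (-ℓ) ℓ, wt x = C / r x) :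
    IsOrthogonalBasisL2 (weightMeasure ℓ wt) fun k x => r x * W k x := by
  rw [weightMeasure_eq hwt]
  have hW := h.continuous_fst
  have hab : -ℓ < ℓ := by linarith
  have hr1 : ∀ x, r x ≠ 0 := fun x => (hr0 x).ne'
  set ρ : ℝ → ℝ := fun x => C / r x with hρdef
  have hρ : Continuous ρ := continuous_const.div hr hr1
  have hρ0 : ∀ x, 0 < ρ x := fun x => div_pos hC (hr0 x)
  have hρr : ∀ x, ρ x * r x = C := fun x => div_mul_cancel₀ _ (hr1 x)
  have hmem : ∀ {f : ℝ → ℝ}, Continuous f → MemLp (fun x => r x * f x) 2 (weightMeasure ℓ ρ) :=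
    fun hf => memLp_weightMeasure hρ (hr.mul hf) 2
  -- Since `ρ r = C`, multiplication by `r` turns the weight `ρ` into `C r`, the weight of the
  -- Sturm–Liouville problem.
  have hinner : ∀ {f g : ℝ → ℝ} (hf : Continuous f) (hg : Continuous g),
      inner ℝ ((hmem hf).toLp _) ((hmem hg).toLp _) = C * ∫ x in (-ℓ)..ℓ, r x * f x * g x := by
    intro f g hf hg
    rw [inner_toLp_toLp_weightMeasure hℓ hρ hρ0, ← intervalIntegral.integral_const_mul]
    congr 1; ext x
    rw [← hρr x]; ring
  refine ⟨fun k => hmem (hW k), fun k h0 => ?_, fun j k hjk => ?_, ?_⟩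
  · have h1 := hinner (hW k) (hW k)
    rw [h0, inner_zero_left] at h1
    have h2 := h.integral_sq_pos hr hr0 hab k
    have e : ∫ x in (-ℓ)..ℓ, r x * W k x * W k x = ∫ x in (-ℓ)..ℓ, r x * W k x ^ 2 := by
      congr 1; ext x; ring
    rw [e] at h1
    exact (mul_pos hC h2).ne h1
  · refine (hinner (hW j) (hW k)).trans ?_
    rw [h.integral_mul_eq_zero hA hr hab.le hjk, mul_zero]
  · set K := Submodule.span ℝ (range fun k => (hmem (hW k)).toLp (fun x => r x * W k x)) with hK
    rw [Submodule.topologicalClosure_eq_top_iff, eq_bot_iff]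
    intro g hg
    have hsum : ∀ (s : Finset ℕ) (c : ℕ → ℝ)
        (hc : Continuous fun x => ∑ k ∈ s, c k * W k x), (hmem hc).toLp _ ∈ K := by
      intro s c hc
      have e : (hmem hc).toLp _ = ∑ k ∈ s, c k • (hmem (hW k)).toLp (fun x => r x * W k x) := by
        refine Lp.ext ?_
        refine (hmem hc).coeFn_toLp.trans ?_
        have h1 : ∀ k, ((c k • (hmem (hW k)).toLp (fun x => r x * W k x) :
            Lp ℝ 2 (weightMeasure ℓ ρ)) : ℝ → ℝ) =ᵐ[weightMeasure ℓ ρ]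
            fun x => c k * (r x * W k x) := fun k => by
          filter_upwards [Lp.coeFn_smul (c k) ((hmem (hW k)).toLp (fun x => r x * W k x)),
            (hmem (hW k)).coeFn_toLp] with x hx hx'
          simp [hx, hx']
        filter_upwards [Lp.coeFn_fun_finsetSum s
          (fun k => c k • (hmem (hW k)).toLp (fun x => r x * W k x)), ae_all_iff.2 h1] with x hx hx'
        rw [hx, Finset.mul_sum]
        exact Finset.sum_congr rfl fun k _ => by rw [hx' k]; ring
      rw [e]
      exact Submodule.sum_mem _ fun k _ => Submodule.smul_mem _ _ (Submodule.subset_span ⟨k, rfl⟩)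
    -- The squared distance to the `n`-th Fourier sum is at most `C E / κ n`.
    have hclosure : ∀ {u u' : ℝ → ℝ} (hu : Continuous u), Continuous u' →
        (∀ x ∈ Icc (-ℓ) ℓ, HasDerivAt u (u' x) x) → u (-ℓ) = 0 → u ℓ = 0 →
        (hmem hu).toLp _ ∈ K.topologicalClosure := by
      intro u u' hu hu' hd hua hub
      choose c hc using
        h.exists_mul_integral_sub_sq_le hA hr hA0 hr0 hab hu hu' hd hua hub
      have hcc : ∀ n, Continuous fun x => ∑ k ∈ Finset.range n, c n k * W k x := fun n => by
        fun_prop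
      refine mem_closure_of_tendsto (b := atTop)
        (f := fun n => (hmem (hcc n)).toLp _) ?_ (Eventually.of_forall fun n => hsum _ _ (hcc n))
      rw [tendsto_iff_norm_sub_tendsto_zero]
      have hsq : Tendsto (fun n => ‖(hmem (hcc n)).toLp _ - (hmem hu).toLp _‖ ^ 2) atTop
          (nhds 0) := by
        set E := ∫ x in (-ℓ)..ℓ, u' x ^ 2 / A x
        have hlim : Tendsto (fun n => C * (E / κ n)) atTop (nhds 0) := by
          simpa using (tendsto_const_nhds.div_atTop h.tendsto).const_mul C
        refine squeeze_zero (fun n => sq_nonneg _) (fun n => ?_) hlim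
        have hR : Continuous fun x => u x - ∑ k ∈ Finset.range n, c n k * W k x :=
          hu.sub (hcc n)
        have e : (hmem hu).toLp _ - (hmem (hcc n)).toLp _ = (hmem hR).toLp _ := by
          rw [← MemLp.toLp_sub]
          refine MemLp.toLp_congr _ _ (Eventually.of_forall fun x => ?_)
          simp [mul_sub]
        rw [norm_sub_rev, e, ← real_inner_self_eq_norm_sq, hinner hR hR]
        refine mul_le_mul_of_nonneg_left ?_ hC.le
        rw [le_div_iff₀' (h.pos n)]
        refine le_trans (le_of_eq ?_) (hc n)
        congr 2; ext x; ring
      have := hsq.sqrt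
      simpa [Real.sqrt_sq] using this
    rw [← Submodule.orthogonal_closure] at hg
    have hgmem := Lp.memLp g
    -- Test functions supported in the open interval satisfy the Dirichlet conditions, so `g` in the
    -- orthogonal complement integrates to zero against all of them.
    have hae := (isOpen_Ioo (a := -ℓ) (b := ℓ)).ae_eq_zero_of_integral_contDiff_smul_eq_zero
      (f := (g : ℝ → ℝ)) (μ := volume)
      (integrableOn_of_memLp_weightMeasure hρ hρ0 hgmem).locallyIntegrableOn
      (fun u hu _ hsupp => by
        have hout : ∀ x ∉ Ioo (-ℓ) ℓ, u x = 0 := fun x hx =>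
          image_eq_zero_of_notMem_tsupport fun hx' => hx (hsupp hx')
        have hmemu := hclosure (u := u) (u' := deriv u) hu.continuous
          (hu.continuous_deriv (by simp))
          (fun x _ => (hu.differentiable (by simp) x).hasDerivAt)
          (hout _ (by simp)) (hout _ (by simp))
        have h0 := hg _ hmemu
        rw [inner_toLp_weightMeasure hρ hρ0] at h0
        have e : ∀ x, ρ x * (r x * u x * g x) = C * (u x * g x) := fun x => by
          rw [← hρr x]; ring
        simp only [e] at h0
        rw [integral_const_mul] at h0
        have h1 := (mul_eq_zero.1 h0).resolve_left hC.ne'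
        rw [← h1]
        symm
        exact setIntegral_eq_integral_of_forall_compl_eq_zero fun x hx => by simp [hout x hx])
    rw [Submodule.mem_bot, Lp.eq_zero_iff_ae_eq_zero]
    exact (withDensity_absolutelyContinuous _ _).ae_le
      ((ae_restrict_iff' measurableSet_Ioo).2 hae)

end WeightMeasure

end SturmLiouville

/-! ### The fluxes and the divergence form of the operator -/

namespace Metastab

open Real

lemma contDiffOn_flux {Q : ℝ → ℝ} (hQ : Q = fluxNonmono ∨ Q = fluxUnbounded) :
    ContDiffOn ℝ 2 Q (Ioo (-1) 1) := by
  rcases hQ with rfl | rfl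
  · refine ContDiff.contDiffOn ?_
    exact contDiff_id.div (by fun_prop) fun s => by positivity
  · have hpos : ∀ s ∈ Ioo (-1 : ℝ) 1, 0 < 1 - s ^ 2 := fun s hs => by nlinarith [hs.1, hs.2]
    exact contDiffOn_id.div (ContDiffOn.sqrt (by fun_prop) fun s hs => (hpos s hs).ne')
      fun s hs => (Real.sqrt_pos.2 (hpos s hs)).ne'

/-- The derivatives are `(1 - s²) / (1 + s²)²` and `(1 - s²)^(-3/2)`. The non-monotone flux is
increasing exactly on this range, which is why the slope bound on `U` matters. -/
lemma deriv_flux_pos {Q : ℝ → ℝ} (hQ : Q = fluxNonmono ∨ Q = fluxUnbounded) {s : ℝ}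
    (hs : s ∈ Ioo (-1 : ℝ) 1) : 0 < deriv Q s := by
  have hpos : 0 < 1 - s ^ 2 := by nlinarith [hs.1, hs.2]
  rcases hQ with rfl | rfl
  · have h : HasDerivAt fluxNonmono ((1 * (1 + s ^ 2) - s * (2 * s)) / (1 + s ^ 2) ^ 2) s := by
      convert! (hasDerivAt_id s).div (((hasDerivAt_id s).pow 2).const_add 1)
        (show (1 : ℝ) + s ^ 2 ≠ 0 by positivity) using 1
      simp
    rw [h.deriv]
    apply div_pos <;> nlinarith [sq_nonneg s]
  · have hsq := Real.sqrt_pos.2 hpos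
    have h : HasDerivAt fluxUnbounded
        ((1 * √(1 - s ^ 2) - s * (-(2 * s) / (2 * √(1 - s ^ 2)))) / √(1 - s ^ 2) ^ 2) s := by
      convert! (hasDerivAt_id s).div ((((hasDerivAt_id s).pow 2).const_sub 1).sqrt
        (by simpa using hpos.ne')) (by simpa using hsq.ne') using 1
      simp
    rw [h.deriv]
    apply div_pos _ (by positivity)
    have : s * (-(2 * s) / (2 * √(1 - s ^ 2))) = -(s ^ 2 / √(1 - s ^ 2)) := by
      field_simp
    rw [this]
    have : 0 ≤ s ^ 2 / √(1 - s ^ 2) := by positivity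
    linarith

section Coefficients

variable {Q f : ℝ → ℝ} {ε ℓ : ℝ} {U : ℝ → ℝ}

lemma contDiffOn_dx {E : Type*} [NormedAddCommGroup E] [NormedSpace ℝ E] (hℓ : 0 < ℓ) {v : ℝ → E}
    (hv : ContDiffOn ℝ 2 v (Icc (-ℓ) ℓ)) : ContDiffOn ℝ 1 (dx ℓ v) (Icc (-ℓ) ℓ) :=
  hv.derivWithin (uniqueDiffOn_Icc (by linarith)) (by norm_num)

lemma hasDerivWithinAt_dx {E : Type*} [NormedAddCommGroup E] [NormedSpace ℝ E] {v : ℝ → E}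
    (hv : ContDiffOn ℝ 1 v (Icc (-ℓ) ℓ)) {x : ℝ} (hx : x ∈ Icc (-ℓ) ℓ) :
    HasDerivWithinAt v (dx ℓ v x) (Icc (-ℓ) ℓ) x :=
  (hv.differentiableOn (by norm_num) x hx).hasDerivWithinAt

lemma hasDerivAt_dx {E : Type*} [NormedAddCommGroup E] [NormedSpace ℝ E] {v : ℝ → E}
    (hv : ContDiffOn ℝ 1 v (Icc (-ℓ) ℓ)) {x : ℝ} (hx : x ∈ Ioo (-ℓ) ℓ) :
    HasDerivAt v (dx ℓ v x) x :=
  (hasDerivWithinAt_dx hv (Ioo_subset_Icc_self hx)).hasDerivAt (Icc_mem_nhds hx.1 hx.2)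

lemma mul_dx_mem (hε : 0 < ε)
    (hUx : ∀ x ∈ Icc (-ℓ) ℓ, -ε⁻¹ < dx ℓ U x ∧ dx ℓ U x < 0) {x : ℝ} (hx : x ∈ Icc (-ℓ) ℓ) :
    ε * dx ℓ U x ∈ Ioo (-1 : ℝ) 1 := by
  obtain ⟨h1, h2⟩ := hUx x hx
  have h3 : ε * -ε⁻¹ < ε * dx ℓ U x := mul_lt_mul_of_pos_left h1 hε
  have h4 : ε * -ε⁻¹ = -1 := by field_simp
  constructor
  · linarith
  · nlinarith

lemma contDiffOn_diffusion (hQ : ContDiffOn ℝ 2 Q (Ioo (-1) 1)) (hℓ : 0 < ℓ)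
    (hU : ContDiffOn ℝ 2 U (Icc (-ℓ) ℓ))
    (hmem : ∀ x ∈ Icc (-ℓ) ℓ, ε * dx ℓ U x ∈ Ioo (-1 : ℝ) 1) :
    ContDiffOn ℝ 1 (fun x => ε * deriv Q (ε * dx ℓ U x)) (Icc (-ℓ) ℓ) :=
  contDiffOn_const.mul ((hQ.deriv_of_isOpen isOpen_Ioo (by norm_num)).comp
    (contDiffOn_const.mul (contDiffOn_dx hℓ hU)) hmem)

lemma contDiffOn_advection (hf : ContDiff ℝ 2 f) (hU : ContDiffOn ℝ 2 U (Icc (-ℓ) ℓ)) :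
    ContDiffOn ℝ 1 (fun x => deriv f (U x)) (Icc (-ℓ) ℓ) :=
  (((contDiff_succ_iff_deriv (n := 1)).1 hf).2.2).comp_contDiffOn (hU.of_le (by norm_num))

/-- The linearized operator is in divergence form. -/
theorem hasDerivAt_linearizedOp {E : Type*} [NormedAddCommGroup E] [NormedSpace ℝ E]
    (hQ : ContDiffOn ℝ 2 Q (Ioo (-1) 1)) (hf : ContDiff ℝ 2 f) (hℓ : 0 < ℓ)
    (hU : ContDiffOn ℝ 2 U (Icc (-ℓ) ℓ))
    (hmem : ∀ x ∈ Icc (-ℓ) ℓ, ε * dx ℓ U x ∈ Ioo (-1 : ℝ) 1)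
    {v : ℝ → E} (hv : ContDiffOn ℝ 2 v (Icc (-ℓ) ℓ)) {x : ℝ} (hx : x ∈ Ioo (-ℓ) ℓ) :
    HasDerivAt (fun y => (ε * deriv Q (ε * dx ℓ U y)) • dx ℓ v y - deriv f (U y) • v y)
      (linearizedOp Q f ε ℓ U v x) x := by
  have hQ' := (hQ.deriv_of_isOpen (m := 1) isOpen_Ioo (by norm_num))
  have hxm := hmem x (Ioo_subset_Icc_self hx)
  have h1 : HasDerivAt (deriv Q) (deriv (deriv Q) (ε * dx ℓ U x)) (ε * dx ℓ U x) :=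
    ((hQ'.differentiableOn (by norm_num) _ hxm).differentiableAt
      (isOpen_Ioo.mem_nhds hxm)).hasDerivAt
  have h2 : HasDerivAt (dx ℓ U) (dx ℓ (dx ℓ U) x) x := hasDerivAt_dx (contDiffOn_dx hℓ hU) hx
  have h3 : HasDerivAt (dx ℓ v) (dx ℓ (dx ℓ v) x) x := hasDerivAt_dx (contDiffOn_dx hℓ hv) hx
  have h4 : HasDerivAt (fun y => deriv f (U y) • v y) (dx ℓ (fun y => deriv f (U y) • v y) x) x :=
    hasDerivAt_dx ((contDiffOn_advection hf hU).smul (hv.of_le (by norm_num))) hx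
  have h5 : HasDerivAt (fun y => ε * deriv Q (ε * dx ℓ U y))
      (ε ^ 2 * deriv (deriv Q) (ε * dx ℓ U x) * dx ℓ (dx ℓ U) x) x := by
    convert! (h1.comp x (h2.const_mul ε)).const_mul ε using 1
    ring
  exact (h5.smul h3).sub h4

end Coefficients

end Metastab

/-! ### Reality and sign of the eigenvalues -/

namespace SturmLiouville

open Real

/-- The eigenvalue of a complex Dirichlet eigenfunction is real and negative. -/
theorem exists_eq_neg_of_complex_solution {A r : ℝ → ℝ} (hA : Continuous A) (hr : Continuous r)
    (hA0 : ∀ x, 0 < A x) (hr0 : ∀ x, 0 < r x) {a b : ℝ} (hab : a < b) {μ : ℂ} {w z : ℝ → ℂ}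
    (hwc : ContinuousOn w (Icc a b)) (hzc : ContinuousOn z (Icc a b))
    (hw : ∀ x ∈ Ioo a b, HasDerivAt w (A x * z x) x)
    (hz : ∀ x ∈ Ioo a b, HasDerivAt z (μ * (r x * w x)) x) (hwa : w a = 0) (hwb : w b = 0)
    (hne : ∃ x ∈ Icc a b, w x ≠ 0) : ∃ κ : ℝ, 0 < κ ∧ μ = -(κ : ℂ) := by
  have hcz : ContinuousOn (fun x => A x * ‖z x‖ ^ 2) (Icc a b) :=
    hA.continuousOn.mul (hzc.norm.pow 2)
  have hcw : ContinuousOn (fun x => r x * ‖w x‖ ^ 2) (Icc a b) :=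
    hr.continuousOn.mul (hwc.norm.pow 2)
  -- If `z` vanished identically, `w` would be constant, hence `0`.
  have hznz : ∃ x ∈ Icc a b, z x ≠ 0 := by
    by_contra! hcon
    obtain ⟨x, hx, hwx⟩ := hne
    refine hwx ((eq_left_of_hasDerivAt_zero hwc (fun y hy => ?_) hx).trans hwa)
    simpa [hcon y (Ioo_subset_Icc_self hy)] using hw y hy
  have hPz : 0 < ∫ x in a..b, A x * ‖z x‖ ^ 2 := by
    obtain ⟨x, hx, hzx⟩ := hznz
    refine intervalIntegral.integral_pos hab hcz (fun y _ => ?_) ⟨x, hx, ?_⟩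
    · have := (hA0 y).le
      positivity
    · have := hA0 x
      have := norm_pos_iff.2 hzx
      positivity
  have hPw : 0 < ∫ x in a..b, r x * ‖w x‖ ^ 2 := by
    obtain ⟨x, hx, hwx⟩ := hne
    refine intervalIntegral.integral_pos hab hcw (fun y _ => ?_) ⟨x, hx, ?_⟩
    · have := (hr0 y).le
      positivity
    · have := hr0 x
      have := norm_pos_iff.2 hwx
      positivity
  have hi1 : IntervalIntegrable (fun x => ((A x * ‖z x‖ ^ 2 : ℝ) : ℂ)) volume a b :=
    (Complex.continuous_ofReal.comp_continuousOn hcz).intervalIntegrable_of_Icc hab.le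
  have hi2 : IntervalIntegrable (fun x => μ * ((r x * ‖w x‖ ^ 2 : ℝ) : ℂ)) volume a b :=
    (continuousOn_const.mul (Complex.continuous_ofReal.comp_continuousOn hcw)).intervalIntegrable_of_Icc
      hab.le
  -- `(w̄ z)' = A |z|² + μ r |w|²`, and `w̄ z` vanishes at both ends.
  have hint := intervalIntegral.integral_eq_sub_of_hasDerivAt_of_le hab.le
    (f := fun x => star (w x) * z x)
    (f' := fun x => ((A x * ‖z x‖ ^ 2 : ℝ) : ℂ) + μ * ((r x * ‖w x‖ ^ 2 : ℝ) : ℂ))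
    (hwc.star.mul hzc) (fun x hx => by
      convert! (hw x hx).star.mul (hz x hx) using 1
      have h1 := Complex.conj_mul' (z x)
      have h2 := Complex.conj_mul' (w x)
      simp only [Complex.star_def, map_mul, Complex.conj_ofReal]
      push_cast
      rw [← h1, ← h2]
      ring) (hi1.add hi2)
  rw [intervalIntegral.integral_add hi1 hi2, intervalIntegral.integral_const_mul,
    intervalIntegral.integral_ofReal, intervalIntegral.integral_ofReal, hwa, hwb] at hint
  simp only [star_zero, zero_mul, sub_zero] at hint
  refine ⟨(∫ x in a..b, A x * ‖z x‖ ^ 2) / ∫ x in a..b, r x * ‖w x‖ ^ 2, div_pos hPz hPw, ?_⟩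
  have hne' : ((∫ x in a..b, r x * ‖w x‖ ^ 2 : ℝ) : ℂ) ≠ 0 := by exact_mod_cast hPw.ne'
  rw [Complex.ofReal_div, eq_neg_iff_add_eq_zero]
  field_simp
  linear_combination hint

end SturmLiouville

/-! ### Passage between the eigenvalue problem and the first order system -/

namespace Metastab

open Real SturmLiouville

section Transformation

variable {Q f : ℝ → ℝ} {ε ℓ : ℝ} {U : ℝ → ℝ} {A ρ : ℝ → ℝ}

/-- A complex eigenfunction `v` gives the solution `w = ρ v`, `z = ε Q'(ε U_x) v_x - f'(U) v` of a
first order system. -/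
theorem IsEigenfunction.exists_firstOrder (hQ : ContDiffOn ℝ 2 Q (Ioo (-1) 1))
    (hf : ContDiff ℝ 2 f) (hℓ : 0 < ℓ) (hU : ContDiffOn ℝ 2 U (Icc (-ℓ) ℓ))
    (hmem : ∀ x ∈ Icc (-ℓ) ℓ, ε * dx ℓ U x ∈ Ioo (-1 : ℝ) 1)
    (hpos : ∀ x ∈ Icc (-ℓ) ℓ, 0 < ε * deriv Q (ε * dx ℓ U x))
    (hρc : Continuous ρ) (hρ0 : ∀ x, 0 < ρ x)
    (hρ : ∀ x ∈ Icc (-ℓ) ℓ,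
      HasDerivAt ρ (ρ x * -(deriv f (U x) / (ε * deriv Q (ε * dx ℓ U x)))) x)
    (hA : ∀ x ∈ Icc (-ℓ) ℓ, A x = ρ x / (ε * deriv Q (ε * dx ℓ U x)))
    {μ : ℂ} {v : ℝ → ℂ} (hv : IsEigenfunction Q f ε ℓ U μ v) :
    ∃ w z : ℝ → ℂ, (∀ x, w x = ρ x * v x) ∧ ContinuousOn w (Icc (-ℓ) ℓ) ∧
      ContinuousOn z (Icc (-ℓ) ℓ) ∧ (∀ x ∈ Ioo (-ℓ) ℓ, HasDerivAt w (A x * z x) x) ∧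
      (∀ x ∈ Ioo (-ℓ) ℓ, HasDerivAt z (μ * ((ρ x)⁻¹ * w x)) x) ∧ w (-ℓ) = 0 ∧ w ℓ = 0 ∧
      ∃ x ∈ Icc (-ℓ) ℓ, w x ≠ 0 := by
  have hρne : ∀ x, (ρ x : ℂ) ≠ 0 := fun x => by exact_mod_cast (hρ0 x).ne'
  have hvd : ContDiffOn ℝ 1 v (Icc (-ℓ) ℓ) := hv.contDiffOn.of_le (by norm_num)
  refine ⟨fun x => ρ x * v x,
    fun y => (ε * deriv Q (ε * dx ℓ U y)) • dx ℓ v y - deriv f (U y) • v y,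
    fun x => rfl, ?_, ?_, fun x hx => ?_, fun x hx => ?_, by simp [hv.left], by simp [hv.right], ?_⟩
  · exact (Complex.continuous_ofReal.comp hρc).continuousOn.mul hvd.continuousOn
  · exact ((contDiffOn_diffusion hQ hℓ hU hmem).continuousOn.smul
      (contDiffOn_dx hℓ hv.contDiffOn).continuousOn).sub
      ((contDiffOn_advection hf hU).continuousOn.smul hvd.continuousOn)
  · have hx' := Ioo_subset_Icc_self hx
    convert! ((hρ x hx').ofReal_comp).mul (hasDerivAt_dx hvd hx) using 1
    have h1 := hpos x hx'
    rw [hA x hx']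
    beta_reduce
    generalize ε * deriv Q (ε * dx ℓ U x) = q at h1 ⊢
    have h2 : (q : ℂ) ≠ 0 := by exact_mod_cast h1.ne'
    simp only [Complex.real_smul]
    push_cast
    field_simp
    ring
  · have := hasDerivAt_linearizedOp hQ hf hℓ hU hmem hv.contDiffOn hx
    rw [hv.equation x hx] at this
    rwa [Complex.ofReal_inv, inv_mul_cancel_left₀ (hρne x)]
  · obtain ⟨x, hx, hvx⟩ := hv.nonzero
    exact ⟨x, hx, mul_ne_zero (hρne x) hvx⟩

lemma contDiffOn_one_of_hasDerivWithinAt (hℓ : 0 < ℓ) {g g' : ℝ → ℝ}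
    (hg : ∀ x ∈ Icc (-ℓ) ℓ, HasDerivWithinAt g (g' x) (Icc (-ℓ) ℓ) x)
    (hg' : ContinuousOn g' (Icc (-ℓ) ℓ)) : ContDiffOn ℝ 1 g (Icc (-ℓ) ℓ) := by
  have hu : UniqueDiffOn ℝ (Icc (-ℓ) ℓ) := uniqueDiffOn_Icc (by linarith)
  refine (contDiffOn_succ_iff_derivWithin (n := 0) hu).2
    ⟨fun x hx => (hg x hx).differentiableWithinAt, by simp, ?_⟩
  rw [contDiffOn_zero]
  exact hg'.congr fun x hx => (hg x hx).derivWithin (hu x hx)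

/-- A solution of the first order system with Dirichlet conditions gives an eigenfunction. -/
theorem isEigenfunction_of_isSolution (hQ : ContDiffOn ℝ 2 Q (Ioo (-1) 1))
    (hf : ContDiff ℝ 2 f) (hℓ : 0 < ℓ) (hU : ContDiffOn ℝ 2 U (Icc (-ℓ) ℓ))
    (hmem : ∀ x ∈ Icc (-ℓ) ℓ, ε * dx ℓ U x ∈ Ioo (-1 : ℝ) 1)
    (hpos : ∀ x ∈ Icc (-ℓ) ℓ, 0 < ε * deriv Q (ε * dx ℓ U x))
    (hρc : Continuous ρ) (hρ0 : ∀ x, 0 < ρ x)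
    (hρ : ∀ x ∈ Icc (-ℓ) ℓ,
      HasDerivAt ρ (ρ x * -(deriv f (U x) / (ε * deriv Q (ε * dx ℓ U x)))) x)
    (hA : ∀ x ∈ Icc (-ℓ) ℓ, A x = ρ x / (ε * deriv Q (ε * dx ℓ U x)))
    {κ : ℝ} {W Z : ℝ → ℝ} (h : IsSolution A (fun x => (ρ x)⁻¹) (-ℓ) ℓ κ W Z)
    (hl : W (-ℓ) = 0) (hr : W ℓ = 0) (hne : ∃ x ∈ Icc (-ℓ) ℓ, W x ≠ 0) :
    IsEigenfunction Q f ε ℓ U (-κ) fun x => (ρ x)⁻¹ * W x := by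
  have hu : UniqueDiffOn ℝ (Icc (-ℓ) ℓ) := uniqueDiffOn_Icc (by linarith)
  have hW := h.continuous_fst
  have hZ := h.continuous_snd
  have hρi : Continuous fun x => (ρ x)⁻¹ := hρc.inv₀ fun x => (hρ0 x).ne'
  have hda := contDiffOn_diffusion hQ hℓ hU hmem
  have hdb := contDiffOn_advection (ℓ := ℓ) hf hU
  set a : ℝ → ℝ := fun x => ε * deriv Q (ε * dx ℓ U x) with ha
  set b : ℝ → ℝ := fun x => deriv f (U x) with hb
  set φ : ℝ → ℝ := fun x => (ρ x)⁻¹ * W x with hφ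
  have hφd : ∀ x ∈ Icc (-ℓ) ℓ, HasDerivAt φ ((Z x + b x * φ x) / a x) x := by
    intro x hx
    convert! ((hρ x hx).inv (hρ0 x).ne').mul (h.hasDerivAt_fst x hx) using 1
    have h1 : a x ≠ 0 := (hpos x hx).ne'
    have h2 := (hρ0 x).ne'
    change _ = -(ρ x * -(b x / a x)) / ρ x ^ 2 * W x + (ρ x)⁻¹ * (A x * Z x)
    rw [hA x hx, hφ]
    change _ = _ + (ρ x)⁻¹ * (ρ x / a x * Z x)
    field_simp
    ring
  have hφc : Continuous φ := hρi.mul hW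
  have hZd : ContDiffOn ℝ 1 Z (Icc (-ℓ) ℓ) := contDiffOn_one_of_hasDerivWithinAt hℓ
    (fun x hx => (h.hasDerivAt_snd x hx).hasDerivWithinAt) (by fun_prop)
  have hφ1 : ContDiffOn ℝ 1 φ (Icc (-ℓ) ℓ) := contDiffOn_one_of_hasDerivWithinAt hℓ
    (fun x hx => (hφd x hx).hasDerivWithinAt)
    ((hZ.continuousOn.add (hdb.continuousOn.mul hφc.continuousOn)).div hda.continuousOn
      fun x hx => (hpos x hx).ne')
  have hdx : ∀ x ∈ Icc (-ℓ) ℓ, dx ℓ φ x = (Z x + b x * φ x) / a x := fun x hx =>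
    (hφd x hx).hasDerivWithinAt.derivWithin (hu x hx)
  -- Bootstrapping: `φ' = (Z + b φ) / a` has a `C¹` right-hand side once `φ` is `C¹`.
  have hφ2 : ContDiffOn ℝ 2 φ (Icc (-ℓ) ℓ) := by
    refine (contDiffOn_succ_iff_derivWithin (n := 1) hu).2
      ⟨fun x hx => (hφd x hx).differentiableAt.differentiableWithinAt, by simp, ?_⟩
    exact ((hZd.add (hdb.mul hφ1)).div hda fun x hx => (hpos x hx).ne').congr hdx
  refine ⟨hφ2, by simp [hφ, hl], by simp [hφ, hr], ?_, fun x hx => ?_⟩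
  · obtain ⟨x, hx, hWx⟩ := hne
    exact ⟨x, hx, mul_ne_zero (inv_ne_zero (hρ0 x).ne') hWx⟩
  · have h1 := hasDerivAt_linearizedOp hQ hf hℓ hU hmem hφ2 hx
    have h2 : HasDerivAt (fun y => (ε * deriv Q (ε * dx ℓ U y)) • dx ℓ φ y - deriv f (U y) • φ y)
        (-(κ * (ρ x)⁻¹ * W x)) x := by
      refine (h.hasDerivAt_snd x (Ioo_subset_Icc_self hx)).congr_of_eventuallyEq ?_
      filter_upwards [Icc_mem_nhds hx.1 hx.2] with y hy
      have h3 : a y ≠ 0 := (hpos y hy).ne'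
      change a y * dx ℓ φ y - b y * φ y = Z y
      rw [hdx y hy]
      field_simp
      ring
    rw [h1.unique h2, hφ]
    ring

end Transformation

/-- A positive continuous function on `ℝ` that is a constant multiple of every weight on
`[-ℓ, ℓ]`. -/
theorem exists_common_weight {ℓ : ℝ} (hℓ : 0 < ℓ) {g : ℝ → ℝ} (hg : ContinuousOn g (Icc (-ℓ) ℓ)) :
    ∃ ρ : ℝ → ℝ, Continuous ρ ∧ (∀ x, 0 < ρ x) ∧
      (∀ x ∈ Icc (-ℓ) ℓ, HasDerivAt ρ (ρ x * -g x) x) ∧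
      ∀ ρ₀ > 0, ∀ x₀ ∈ Icc (-ℓ) ℓ, ∃ C > 0, ∀ x ∈ Icc (-ℓ) ℓ,
        ρ₀ * exp (-∫ s in x₀..x, g s) = C * ρ x := by
  have hle : -ℓ ≤ ℓ := by linarith
  set q : ℝ → ℝ := IccExtend hle ((Icc (-ℓ) ℓ).domRestrict g)
  have hq : Continuous q := (continuousOn_iff_continuous_domRestrict.1 hg).Icc_extend'
  have hqg : ∀ x ∈ Icc (-ℓ) ℓ, q x = g x := fun x hx => by
    simp only [q]
    rw [IccExtend_of_mem _ _ hx]; rfl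
  have hd : ∀ x, HasDerivAt (fun x => exp (-∫ s in (-ℓ)..x, q s))
      (exp (-∫ s in (-ℓ)..x, q s) * -q x) x := fun x =>
    ((hq.integral_hasStrictDerivAt (-ℓ) x).hasDerivAt.neg).exp
  refine ⟨fun x => exp (-∫ s in (-ℓ)..x, q s),
    continuous_iff_continuousAt.2 fun x => (hd x).continuousAt, fun x => exp_pos _,
    fun x hx => hqg x hx ▸ hd x, fun ρ₀ hρ₀ x₀ hx₀ => ?_⟩
  -- Moving the base point from `-ℓ` to `x₀` only changes the constant.
  refine ⟨ρ₀ * exp (∫ s in (-ℓ)..x₀, q s), by positivity, fun x hx => ?_⟩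
  have h1 : ∫ s in x₀..x, g s = ∫ s in x₀..x, q s :=
    intervalIntegral.integral_congr fun s hs => (hqg s (uIcc_subset_Icc hx₀ hx hs)).symm
  rw [h1, ← intervalIntegral.integral_interval_sub_left (hq.intervalIntegrable (-ℓ) x)
    (hq.intervalIntegrable (-ℓ) x₀), mul_assoc, ← exp_add]
  congr 2
  ring

end Metastab

/-! ### Assembly -/

theorem mainTheorem9 (Q f : ℝ → ℝ)
    (hQ : Q = Metastab.fluxNonmono ∨ Q = Metastab.fluxUnbounded)
    (hf : ContDiff ℝ 2 f)
    (ε ℓ : ℝ) (hε : 0 < ε) (hℓ : 0 < ℓ)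
    (U : ℝ → ℝ) (hU : ContDiffOn ℝ 2 U (Set.Icc (-ℓ) ℓ))
    (hUx : ∀ x ∈ Set.Icc (-ℓ) ℓ, -ε⁻¹ < Metastab.dx ℓ U x ∧ Metastab.dx ℓ U x < 0) :
    ∃ (eig : ℕ → ℝ) (φ : ℕ → ℝ → ℝ),
      -- `eig k` is the eigenvalue number `k + 1`, and `φ k` its eigenfunction
      (∀ k, Metastab.IsEigenfunction Q f ε ℓ U (eig k) (φ k)) ∧
      StrictAnti eig ∧ (∀ k, eig k < 0) ∧
      Filter.Tendsto eig Filter.atTop Filter.atBot ∧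
      -- every eigenvalue, real or complex, is one of these
      (∀ (μ : ℂ) (v : ℝ → ℂ), Metastab.IsEigenfunction Q f ε ℓ U μ v → ∃ k, μ = (eig k : ℂ)) ∧
      -- each eigenvalue is simple
      (∀ (k : ℕ) (v : ℝ → ℂ), Metastab.IsEigenfunction Q f ε ℓ U (eig k : ℂ) v →
        ∃ c : ℂ, ∀ x ∈ Set.Icc (-ℓ) ℓ, v x = c * (φ k x : ℂ)) ∧
      -- eigenfunction number `k + 1` has exactly `k` zeros in the open interval
      (∀ k : ℕ, {x ∈ Set.Ioo (-ℓ) ℓ | φ k x = 0}.encard = k) ∧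
      (∀ ρ₀ > 0, ∀ x₀ ∈ Set.Icc (-ℓ) ℓ,
        Metastab.IsOrthogonalBasisL2
          (Metastab.weightMeasure ℓ (Metastab.weight Q f ε ℓ U ρ₀ x₀)) φ) := by
  have hle : -ℓ ≤ ℓ := by linarith
  have hab : -ℓ < ℓ := by linarith
  have hQ2 := Metastab.contDiffOn_flux hQ
  have hmem : ∀ x ∈ Icc (-ℓ) ℓ, ε * Metastab.dx ℓ U x ∈ Ioo (-1 : ℝ) 1 := fun x hx =>
    Metastab.mul_dx_mem hε hUx hx
  have hpos : ∀ x ∈ Icc (-ℓ) ℓ, 0 < ε * deriv Q (ε * Metastab.dx ℓ U x) := fun x hx =>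
    mul_pos hε (Metastab.deriv_flux_pos hQ (hmem x hx))
  have hda := (Metastab.contDiffOn_diffusion hQ2 hℓ hU hmem).continuousOn
  have hdb := (Metastab.contDiffOn_advection (ℓ := ℓ) hf hU).continuousOn
  obtain ⟨ρ, hρc, hρ0, hρ, hρw⟩ := Metastab.exists_common_weight hℓ
    (hdb.div hda fun x hx => (hpos x hx).ne')
  -- The Sturm–Liouville results want coefficients continuous and positive on all of `ℝ`; constant
  -- extension beyond the end points provides this.
  set d : ℝ → ℝ := IccExtend hle
    ((Icc (-ℓ) ℓ).domRestrict fun x => ε * deriv Q (ε * Metastab.dx ℓ U x))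
  have hdc : Continuous d := (continuousOn_iff_continuous_domRestrict.1 hda).Icc_extend'
  have hd0 : ∀ x, 0 < d x := fun x => hpos _ (projIcc (-ℓ) ℓ hle x).2
  have hdeq : ∀ x ∈ Icc (-ℓ) ℓ, d x = ε * deriv Q (ε * Metastab.dx ℓ U x) := fun x hx => by
    simp only [d]
    rw [IccExtend_of_mem _ _ hx]; rfl
  set A : ℝ → ℝ := fun x => ρ x / d x
  have hAc : Continuous A := hρc.div hdc fun x => (hd0 x).ne'
  have hA0 : ∀ x, 0 < A x := fun x => div_pos (hρ0 x) (hd0 x)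
  have hA : ∀ x ∈ Icc (-ℓ) ℓ, A x = ρ x / (ε * deriv Q (ε * Metastab.dx ℓ U x)) := fun x hx => by
    simp only [A, hdeq x hx]
  have hrc : Continuous fun x => (ρ x)⁻¹ := hρc.inv₀ fun x => (hρ0 x).ne'
  have hr0 : ∀ x, 0 < (ρ x)⁻¹ := fun x => inv_pos.2 (hρ0 x)
  obtain ⟨κ, W, Z, hsys⟩ := SturmLiouville.exists_isEigensystem hAc hrc hA0 hr0 hab
  have hfirst {μ : ℂ} {v : ℝ → ℂ} (hv : Metastab.IsEigenfunction Q f ε ℓ U μ v) :=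
    hv.exists_firstOrder hQ2 hf hℓ hU hmem hpos hρc hρ0 hρ hA
  refine ⟨fun k => -κ k, fun k x => (ρ x)⁻¹ * W k x, fun k => ?_,
    fun i j hij => neg_lt_neg (hsys.strictMono hij), fun k => neg_neg_of_pos (hsys.pos k),
    tendsto_neg_atTop_atBot.comp hsys.tendsto, fun μ v hv => ?_, fun k v hv => ?_, fun k => ?_,
    fun ρ₀ hρ₀ x₀ hx₀ => ?_⟩
  · refine Metastab.isEigenfunction_of_isSolution hQ2 hf hℓ hU hmem hpos hρc hρ0 hρ hA
      (hsys.isSolution k) (hsys.left k) (hsys.right k) ?_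
    by_contra! hcon
    have h0 := hsys.integral_sq_pos hrc hr0 hab k
    rw [intervalIntegral.integral_congr (g := fun _ => (0 : ℝ)) fun x hx => by
      rw [uIcc_of_le hle] at hx
      simp [hcon x hx]] at h0
    simp at h0
  · obtain ⟨w, z, -, hwc, hzc, hw, hz, hwl, hwr, hne⟩ := hfirst hv
    obtain ⟨m, hm, rfl⟩ := SturmLiouville.exists_eq_neg_of_complex_solution hAc hrc hA0 hr0 hab
      hwc hzc hw (fun x hx => by simpa using hz x hx) hwl hwr hne
    obtain ⟨k, rfl⟩ := hsys.eigenvalue_mem m w z hm hwc hzc hw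
      (fun x hx => by simpa [mul_assoc] using hz x hx) hwl hwr hne
    exact ⟨k, by simp⟩
  · obtain ⟨w, z, hwv, hwc, hzc, hw, hz, hwl, -, -⟩ := hfirst hv
    obtain ⟨c, hc⟩ := (hsys.isSolution k).eq_mul_of_left_eq_zero (hsys.left k)
      (hsys.sq_add_sq_pos k) hwc hzc hw (fun x hx => by simpa [mul_assoc] using hz x hx) hwl
    refine ⟨c, fun x hx => ?_⟩
    have h1 := (hc x hx).1
    have h2 : (ρ x : ℂ) ≠ 0 := by exact_mod_cast (hρ0 x).ne'
    rw [hwv x] at h1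
    push_cast
    field_simp
    linear_combination h1
  · rw [← hsys.encard_zeros k]
    congr 1
    ext x
    simp [(hρ0 x).ne']
  · obtain ⟨C, hC, hCw⟩ := hρw ρ₀ hρ₀ x₀ hx₀
    refine hsys.isOrthogonalBasisL2 hℓ hAc hrc hA0 hr0 hC fun x hx => ?_
    -- With `r = 1 / ρ`, the weight `C ρ` is `C / r`.
    rw [div_inv_eq_mul]
    exact hCw x (Ioo_subset_Icc_self hx)
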